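/- Let $F(a,b)$ be a $2\times2$-matrix-valued Laurent polynomial in two commuting variables $a,b$ with complex coefficients. The degree $\deg_a F$ (resp. $\deg_b F$) is the largest absolute value of an exponent of $a$ (resp. $b$) that occurs in $F$. For $d_a,d_b\in\mathbb N$ consider the conditions 1. $\deg_a F\le d_a$ and $\deg_b F\le d_b$; 2. $F(a,b)\in\mathrm{SU}(2)$ for all $(a,b)\in\mathrm U(1)\times\mathrm U(1)$; 3. $F(-a,b)=(-1)^{d_a}F(a,b)$ and $F(a,-b)=(-1)^{d_b}F(a,b)$. We say that $F$ has a product decomposition if for some $d\ge 0$ $$F(a,b)=U_0\begin{pmatrix}c_1&0\\0&c_1^{-1}\end{pmatrix}U_1\cdots\begin{pmatrix}c_d&0\\0&c_d^{-1}\end{pmatrix}U_d,\qquad U_i\in\mathrm{SU}(2),\ c_i\in\{a,b\}. \qquad(*)$$ (i) If $F$ satisfies conditions 1–3 for some $d_a,d_b\in\mathbb N$ and $\deg_a F\le 1$ or $\deg_b F\le 1$, then $F$ has a product decomposition $(*)$. (ii) This fails in general when both degrees are at least $2$. For a Laurent polynomial $p$ let $p^*$ be the Laurent polynomial with complex conjugated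 coefficients, and let $$F_{2,2}(a,b)=\begin{pmatrix}P(a,b)&Q(a,b)\\-Q^*(a^{-1},b^{-1})&P^*(a^{-1},b^{-1})\end{pmatrix},$$ $$P=\tfrac{6}{25}\sqrt{\tfrac{37}{493}}\Big[a^2b^2+a^{-2}b^{-2}-\left(\tfrac{122}{37}+\tfrac{8i}{37}\right)(b^2+b^{-2})+\left(\tfrac{114}{37}+\tfrac{56i}{37}\right)(a^{-2}b^2+a^2b^{-2})+\left(\tfrac{362}{111}-\tfrac{248i}{111}\right)(a^2+a^{-2})+\tfrac{692}{111}-\tfrac{719i}{222}\Big],$$ $$Q=\tfrac{6}{25}\sqrt{\tfrac{37}{493}}\Big[a^2b^2-a^{-2}b^{-2}-\left(\tfrac{122}{37}+\tfrac{66i}{37}\right)(b^2-b^{-2})+\left(\tfrac{56}{37}+\tfrac{114i}{37}\right)(a^{-2}b^2-a^2b^{-2})+\left(\tfrac{362}{111}-\tfrac{418i}{111}\right)(a^2-a^{-2})\Big].$$ Then $F_{2,2}$ satisfies conditions 1–3 with $d_a=d_b=2$, and $\deg_aF_{2,2}=\deg_bF_{2,2}=2$, but $F_{2,2}$ has no product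 decomposition $(*)$. (iii) Moreover $P(a^{-1},b^{-1})=P(a,b)$ and $Q(a^{-1},b^{-1})=-Q(a,b)$, and $F_{2,2}$ is not of the restricted form $R_0X(c_1)R_1\cdots X(c_d)R_d$ with $d\ge0$, $c_k\in\{a,b\}$, $R_k=\mathrm{diag}(e^{i\varphi_k},e^{-i\varphi_k})$, $\varphi_k\in\mathbb R$, and $$X(c)=\frac12\begin{pmatrix}c+c^{-1}&c-c^{-1}\\c-c^{-1}&c+c^{-1}\end{pmatrix};$$ nor is the coefficient of $a^2$ in $P$ (a Laurent polynomial in $b$) equal to a complex number of modulus one times the coefficient of $a^2$ in $Q$, and likewise for the coefficients of $b^2$. Hence conditions 1–3 together with these inversion symmetries do not characterize the restricted products, which refutes the characterization conjectured by Rossi and Chuang (their Conjecture 2.1). -/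

import Mathlib

namespace MQSP

noncomputable section

/-- Bivariate complex Laurent polynomials `ℂ[a, a⁻¹, b, b⁻¹]`:
the coefficient of `a ^ j * b ^ k` is `p.coeff (j, k)`. -/
abbrev BiLaurent : Type := AddMonoidAlgebra ℂ (ℤ × ℤ)

/-- Matrix-valued (`2 × 2`) bivariate Laurent polynomials. -/
abbrev MatLaurent : Type := Matrix (Fin 2) (Fin 2) BiLaurent

/-- The Laurent monomial `a ^ j * b ^ k`. -/
def mono (j k : ℤ) : BiLaurent := AddMonoidAlgebra.single (j, k) 1

/-- Evaluation of a bivariate Laurent polynomial at nonzero complex numbers. -/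
def evalAt (a b : ℂˣ) : BiLaurent →ₐ[ℂ] ℂ :=
  AddMonoidAlgebra.lift ℂ ℂ (ℤ × ℤ)
    { toFun := fun m => ((a ^ m.toAdd.1 * b ^ m.toAdd.2 : ℂˣ) : ℂ)
      map_one' := by simp
      map_mul' := by
        intro x y
        simp only [toAdd_mul, Prod.fst_add, Prod.snd_add, zpow_add]
        push_cast
        ring }

/-- The value `F(a, b)` of a matrix-valued Laurent polynomial. -/
def matEval (F : MatLaurent) (a b : ℂˣ) : Matrix (Fin 2) (Fin 2) ℂ :=
  F.map (evalAt a b)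

/-- The largest exponent of `a` or `a⁻¹` occurring in a scalar Laurent polynomial. -/
def degA (p : BiLaurent) : ℕ := p.coeff.support.sup fun m => m.1.natAbs

/-- The largest exponent of `b` or `b⁻¹` occurring in a scalar Laurent polynomial. -/
def degB (p : BiLaurent) : ℕ := p.coeff.support.sup fun m => m.2.natAbs

/-- The degree of `F` in the variable `a`. -/
def matDegA (F : MatLaurent) : ℕ :=
  Finset.univ.sup fun ij : Fin 2 × Fin 2 => degA (F ij.1 ij.2)

/-- The degree of `F` in the variable `b`. -/
def matDegB (F : MatLaurent) : ℕ :=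
  Finset.univ.sup fun ij : Fin 2 × Fin 2 => degB (F ij.1 ij.2)

/-- The degree bounds, the unitarity on the torus and the parities that every product with
`da` occurrences of the variable `a` and `db` occurrences of the variable `b` satisfies. -/
structure SatisfiesConditions (F : MatLaurent) (da db : ℕ) : Prop where
  degA_le : matDegA F ≤ da
  degB_le : matDegB F ≤ db
  mem_su : ∀ a b : Circle,
    matEval F (Circle.toUnits a) (Circle.toUnits b) ∈ Matrix.specialUnitaryGroup (Fin 2) ℂ
  parityA : ∀ a b : ℂˣ, matEval F (-a) b = ((-1 : ℂ) ^ da) • matEval F a b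
  parityB : ∀ a b : ℂˣ, matEval F a (-b) = ((-1 : ℂ) ^ db) • matEval F a b

/-- The two names of variables. -/
inductive Var : Type
  | a
  | b

/-- The variable itself, as a Laurent polynomial. -/
def Var.toPoly : Var → BiLaurent
  | Var.a => mono 1 0
  | Var.b => mono 0 1

/-- The inverse of the variable, as a Laurent polynomial. -/
def Var.invPoly : Var → BiLaurent
  | Var.a => mono (-1) 0
  | Var.b => mono 0 (-1)

/-- A constant matrix, as a matrix-valued Laurent polynomial. -/
def constMat (M : Matrix (Fin 2) (Fin 2) ℂ) : MatLaurent :=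
  M.map (algebraMap ℂ BiLaurent)

/-- The signal matrix `diag(c, c⁻¹)`. -/
def signal (c : Var) : MatLaurent :=
  !![c.toPoly, 0; 0, c.invPoly]

/-- `F = U₀ diag(c₁, c₁⁻¹) U₁ ⋯ diag(c_d, c_d⁻¹) U_d` with `U_i ∈ SU(2)` and `c_i ∈ {a, b}`. -/
def HasProductDecomposition (F : MatLaurent) : Prop :=
  ∃ (d : ℕ) (U : Fin (d + 1) → Matrix.specialUnitaryGroup (Fin 2) ℂ) (c : Fin d → Var),
    F = constMat (U 0).1 *
      (List.ofFn fun i : Fin d => signal (c i) * constMat (U i.succ).1).prod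

/-- Conjugation of the coefficients, `p ↦ p^*`. -/
def conjCoeff : BiLaurent →+* BiLaurent :=
  AddMonoidAlgebra.mapRingHom (ℤ × ℤ) (starRingEnd ℂ)

/-- The substitution `p(a, b) ↦ p(a⁻¹, b⁻¹)`. -/
def invVars : BiLaurent →+* BiLaurent :=
  AddMonoidAlgebra.mapDomainRingHom ℂ (negAddMonoidHom : ℤ × ℤ →+ ℤ × ℤ)

/-- The matrix `[[P, Q], [-Q^*(a⁻¹, b⁻¹), P^*(a⁻¹, b⁻¹)]]`. -/
def quatMat (P Q : BiLaurent) : MatLaurent :=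
  !![P, Q; -invVars (conjCoeff Q), invVars (conjCoeff P)]

/-- The normalising factor of the counterexample. -/
def kappa : ℂ := ((6 / 25 * Real.sqrt (37 / 493) : ℝ) : ℂ)

/-- The upper left entry of the counterexample. -/
def P22 : BiLaurent :=
  kappa • (mono 2 2 + mono (-2) (-2)
    - (122 / 37 + 8 * Complex.I / 37 : ℂ) • (mono 0 2 + mono 0 (-2))
    + (114 / 37 + 56 * Complex.I / 37 : ℂ) • (mono (-2) 2 + mono 2 (-2))
    + (362 / 111 - 248 * Complex.I / 111 : ℂ) • (mono 2 0 + mono (-2) 0)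
    + (692 / 111 - 719 * Complex.I / 222 : ℂ) • mono 0 0)

/-- The upper right entry of the counterexample. -/
def Q22 : BiLaurent :=
  kappa • (mono 2 2 - mono (-2) (-2)
    - (122 / 37 + 66 * Complex.I / 37 : ℂ) • (mono 0 2 - mono 0 (-2))
    + (56 / 37 + 114 * Complex.I / 37 : ℂ) • (mono (-2) 2 - mono 2 (-2))
    + (362 / 111 - 418 * Complex.I / 111 : ℂ) • (mono 2 0 - mono (-2) 0))

/-- The counterexample of degree two in each of the variables. -/
def F22 : MatLaurent := quatMat P22 Q22

/-- The signal matrix `e ^ (i θ σ_X)` for `c = e ^ (i θ)`, that is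
`[[(c + c⁻¹) / 2, (c - c⁻¹) / 2], [(c - c⁻¹) / 2, (c + c⁻¹) / 2]]`. -/
def signalX (c : Var) : MatLaurent :=
  !![(1 / 2 : ℂ) • (c.toPoly + c.invPoly), (1 / 2 : ℂ) • (c.toPoly - c.invPoly);
     (1 / 2 : ℂ) • (c.toPoly - c.invPoly), (1 / 2 : ℂ) • (c.toPoly + c.invPoly)]

/-- The Pauli-`Z` rotation `e ^ (i φ σ_Z)`. -/
def rotZ (φ : ℝ) : Matrix (Fin 2) (Fin 2) ℂ :=
  !![Complex.exp (φ * Complex.I), 0; 0, Complex.exp (-(φ * Complex.I))]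

/-- The restricted products in which the signals are Pauli-`X` rotations and the modulating
matrices are Pauli-`Z` rotations. -/
def HasRestrictedDecomposition (F : MatLaurent) : Prop :=
  ∃ (d : ℕ) (φ : Fin (d + 1) → ℝ) (c : Fin d → Var),
    F = constMat (rotZ (φ 0)) *
      (List.ofFn fun i : Fin d => signalX (c i) * constMat (rotZ (φ i.succ))).prod

end

end MQSP

/-!
Write `dag p = p^*(a⁻¹, b⁻¹)`. Unitarity on the torus says that a matrix `F` satisfying the
conditions has the shape `[[p, q], [-dag q, dag p]]` with `p * dag p + q * dag q = 1`, because a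
Laurent polynomial vanishing on the torus is zero.

*Sufficiency.* By the symmetry between `a` and `b` the degree in `b` may be taken to be at most
one. A factor `U * diag(a, a⁻¹)` can be split off from the left, lowering the degree in `a`, as
soon as some nonzero row vector annihilates all coefficients of the lowest power of `a`
(`IsQSP.peelA`), and similarly for `b`. If `b` does not occur, such a vector exists since the
lowest coefficient is singular (`IsQSP.exists_killsA_of_succ_zero`). If the degree in `b` is one,
then `F = b A + b⁻¹ B`, and `P = A A†`, with the adjoint on the torus, is a projection-valued
Laurent polynomial in `a` with `P A = A` and `P B = 0`. Either `P` has a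
negative power of `a`, and a row of its lowest coefficient
annihilates the lowest coefficients of `A` and of `B`; or `P` is constant, and one of its rows
annihilates `B` (`IsQSP.killsA_or_killsB`). Hence induction on the degrees applies.

*Counterexample.* In a product, the factors in `a` between consecutive signals in `b` can be
collected, and two signals in `b` cancel when the factor between them has zero diagonal. After all
cancellations the coefficient of the highest power of `b` is a column `u(a)` of an `SU(2)`-valued
Laurent polynomial times a row (`HasProductDecomposition.exists_column`). For `F22` the ratio of
the two rows of that coefficient is `(a ^ 2 - 1 - i) : (a ^ 2 - 1 + i)`, and no multiple of this
column has norm one on the torus; evaluation at a point where `a ^ 2 + a ^ (-2) = 3` turns this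
into a contradiction (`not_hasProductDecomposition_F22`). A restricted product is in particular a
product, since its signals are conjugate to diagonal ones.
-/

namespace MQSP

noncomputable section

open AddMonoidAlgebra

/-! ### Coefficients and substitutions -/

theorem coeff_mono (j k : ℤ) (m : ℤ × ℤ) : (mono j k).coeff m = if m = (j, k) then 1 else 0 := by
  simp [mono, Finsupp.single_apply, eq_comm]

theorem coeff_mono_mul (j k : ℤ) (p : BiLaurent) (m : ℤ × ℤ) :
    (mono j k * p).coeff m = p.coeff (m - (j, k)) := by
  rw [mono, coeff_single_mul_eq_mul_coeff (m - (j, k)), one_mul]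
  intro m' _
  exact eq_sub_iff_add_eq'.symm

theorem mono_mul_mono (j k j' k' : ℤ) : mono j k * mono j' k' = mono (j + j') (k + k') := by
  simp [mono]

theorem mono_zero : mono 0 0 = 1 := rfl

theorem coeff_algebraMap (c : ℂ) (m : ℤ × ℤ) :
    (algebraMap ℂ BiLaurent c).coeff m = if m = 0 then c else 0 := by
  simp [AddMonoidAlgebra.coe_algebraMap, Finsupp.single_apply, eq_comm]

/-- The adjoint `p ↦ p^*(a⁻¹, b⁻¹)`; on the torus it is pointwise complex conjugation. -/
def dag : BiLaurent →+* BiLaurent := invVars.comp conjCoeff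

theorem coeff_invVars (p : BiLaurent) (m : ℤ × ℤ) : (invVars p).coeff m = p.coeff (-m) := by
  induction p using AddMonoidAlgebra.induction_linear with
  | zero => simp
  | add p q hp hq => simp [hp, hq]
  | single n c =>
    simp [invVars, Finsupp.single_apply, neg_eq_iff_eq_neg]

theorem coeff_conjCoeff (p : BiLaurent) (m : ℤ × ℤ) :
    (conjCoeff p).coeff m = star (p.coeff m) := by
  simp [conjCoeff]

theorem coeff_dag (p : BiLaurent) (m : ℤ × ℤ) : (dag p).coeff m = star (p.coeff (-m)) := by
  simp only [dag, RingHom.comp_apply, coeff_invVars, coeff_conjCoeff]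

@[simp] theorem dag_dag (p : BiLaurent) : dag (dag p) = p := by
  ext m; simp [coeff_dag]

theorem dag_smul (c : ℂ) (p : BiLaurent) : dag (c • p) = star c • dag p := by
  ext m; simp [coeff_dag]

theorem dag_algebraMap (c : ℂ) :
    dag (algebraMap ℂ BiLaurent c) = algebraMap ℂ BiLaurent (star c) := by
  ext m; simp only [coeff_dag, coeff_algebraMap, neg_eq_zero]; split_ifs <;> simp

theorem dag_mono (j k : ℤ) : dag (mono j k) = mono (-j) (-k) := by
  ext m
  have : -m = (j, k) ↔ m = (-j, -k) := by rw [neg_eq_iff_eq_neg]; rfl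
  simp only [coeff_dag, coeff_mono, this]; split_ifs <;> simp

theorem quatMat_eq (p q : BiLaurent) : quatMat p q = !![p, q; -dag q, dag p] := rfl

/-- The substitution exchanging `a` and `b`. -/
def swapVars : BiLaurent →+* BiLaurent :=
  AddMonoidAlgebra.mapDomainRingHom ℂ ((AddEquiv.prodComm : ℤ × ℤ ≃+ ℤ × ℤ) : ℤ × ℤ →+ ℤ × ℤ)

theorem coeff_swapVars (p : BiLaurent) (m : ℤ × ℤ) :
    (swapVars p).coeff m = p.coeff m.swap := by
  induction p using AddMonoidAlgebra.induction_linear with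
  | zero => simp
  | add p q hp hq => simp [hp, hq]
  | single n c =>
    have : n.swap = m ↔ n = m.swap := by
      constructor <;> rintro rfl <;> simp
    simp [swapVars, Finsupp.single_apply, this]

@[simp] theorem swapVars_swapVars (p : BiLaurent) : swapVars (swapVars p) = p := by
  ext m; simp [coeff_swapVars]

theorem swapVars_dag (p : BiLaurent) : swapVars (dag p) = dag (swapVars p) := by
  ext m; simp [coeff_swapVars, coeff_dag]

theorem swapVars_mono (j k : ℤ) : swapVars (mono j k) = mono k j := by
  simp [swapVars, mono]

theorem swapVars_algebraMap (c : ℂ) :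
    swapVars (algebraMap ℂ BiLaurent c) = algebraMap ℂ BiLaurent c := by
  simp [swapVars, AddMonoidAlgebra.coe_algebraMap]

/-! ### Operations on product decompositions -/

theorem hasProductDecomposition_constMat (U : Matrix.specialUnitaryGroup (Fin 2) ℂ) :
    HasProductDecomposition (constMat U.1) :=
  ⟨0, fun _ => U, Fin.elim0, by simp⟩

theorem HasProductDecomposition.cons {G : MatLaurent} (hG : HasProductDecomposition G)
    (U : Matrix.specialUnitaryGroup (Fin 2) ℂ) (v : Var) :
    HasProductDecomposition (constMat U.1 * signal v * G) := by
  obtain ⟨d, V, c, rfl⟩ := hG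
  refine ⟨d + 1, Fin.cons U V, Fin.cons v c, ?_⟩
  simp [List.ofFn_succ, Matrix.mul_assoc]

theorem constMat_mul (M N : Matrix (Fin 2) (Fin 2) ℂ) :
    constMat (M * N) = constMat M * constMat N := Matrix.map_mul

theorem HasProductDecomposition.constMat_mul {G : MatLaurent} (hG : HasProductDecomposition G)
    (U : Matrix.specialUnitaryGroup (Fin 2) ℂ) :
    HasProductDecomposition (constMat U.1 * G) := by
  obtain ⟨d, V, c, rfl⟩ := hG
  refine ⟨d, Fin.cases (U * V 0) fun i => V i.succ, c, ?_⟩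
  simp [MQSP.constMat_mul, Matrix.mul_assoc]

/-- Induction on the number of factors, peeled off from the left. -/
theorem HasProductDecomposition.induction {motive : MatLaurent → Prop}
    (const : ∀ U : Matrix.specialUnitaryGroup (Fin 2) ℂ, motive (constMat U.1))
    (step : ∀ (U : Matrix.specialUnitaryGroup (Fin 2) ℂ) (v : Var) (G : MatLaurent),
      motive G → motive (constMat U.1 * signal v * G))
    {F : MatLaurent} (hF : HasProductDecomposition F) : motive F := by
  obtain ⟨d, U, c, rfl⟩ := hF
  induction d with
  | zero => simpa using const (U 0)
  | succ d ih =>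
    have := step (U 0) (c 0) _ (ih (fun i => U i.succ) fun i => c i.succ)
    simpa [List.ofFn_succ, Matrix.mul_assoc] using this

/-- The other variable. -/
def Var.other : Var → Var
  | Var.a => Var.b
  | Var.b => Var.a

theorem HasProductDecomposition.map_swapVars {F : MatLaurent} (hF : HasProductDecomposition F) :
    HasProductDecomposition (F.map swapVars) := by
  have hconst : ∀ M : Matrix (Fin 2) (Fin 2) ℂ, (constMat M).map swapVars = constMat M := by
    intro M; ext i j : 1; simp only [constMat, Matrix.map_apply, swapVars_algebraMap]
  refine HasProductDecomposition.induction
    (motive := fun F => HasProductDecomposition (F.map swapVars)) ?_ ?_ hF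
  · intro U; rw [hconst]; exact hasProductDecomposition_constMat U
  · intro U v G ih
    have hs : (signal v).map swapVars = signal v.other := by
      ext i j : 1
      fin_cases i <;> fin_cases j <;> cases v <;>
        simp [signal, Var.other, Var.toPoly, Var.invPoly, swapVars_mono]
    rw [Matrix.map_mul, Matrix.map_mul, hconst, hs]
    exact ih.cons U v.other

theorem quatMat_map_swapVars (p q : BiLaurent) :
    (quatMat p q).map swapVars = quatMat (swapVars p) (swapVars q) := by
  ext i j : 1
  fin_cases i <;> fin_cases j <;> simp [quatMat_eq, swapVars_dag]

/-! ### Pairs of polynomials with quaternionic matrices, and peeling off a factor -/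

/-- All exponents `(j, k)` occurring in `p` satisfy `|j| ≤ d`, `|k| ≤ e`, `j ≡ d` and `k ≡ e`
modulo two. -/
def SupportedInBox (d e : ℕ) (p : BiLaurent) : Prop :=
  ∀ m, p.coeff m ≠ 0 → |m.1| ≤ d ∧ |m.2| ≤ e ∧ (m.1 - d) % 2 = 0 ∧ (m.2 - e) % 2 = 0

/-- The first row `(p, q)` of a matrix satisfying the conditions with degrees `d` and `e`, in
terms of coefficients: the matrix `quatMat p q` has determinant one, and the exponents obey the
bounds and the parities. The second row is determined by the first. -/
structure IsQSP (p q : BiLaurent) (d e : ℕ) : Prop where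
  norm : p * dag p + q * dag q = 1
  supp_left : SupportedInBox d e p
  supp_right : SupportedInBox d e q

theorem IsQSP.swap {p q : BiLaurent} {d e : ℕ} (h : IsQSP p q d e) :
    IsQSP (swapVars p) (swapVars q) e d where
  norm := by
    rw [← swapVars_dag, ← swapVars_dag, ← map_mul, ← map_mul, ← map_add, h.norm, map_one]
  supp_left m hm := by
    rw [coeff_swapVars] at hm
    have := h.supp_left _ hm
    simp only [Prod.fst_swap, Prod.snd_swap] at this
    tauto
  supp_right m hm := by
    rw [coeff_swapVars] at hm
    have := h.supp_right _ hm
    simp only [Prod.fst_swap, Prod.snd_swap] at this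
    tauto

/-- The row vector `(x, y)` annihilates from the left all coefficient matrices of `quatMat p q` that
belong to `a ^ (-d)`. Its lower row `(-dag q, dag p)` is written out in terms of `p` and `q`. -/
def KillsA (p q : BiLaurent) (d : ℕ) (x y : ℂ) : Prop :=
  ∀ k : ℤ, x * p.coeff (-d, k) - y * star (q.coeff (d, -k)) = 0 ∧
    x * q.coeff (-d, k) + y * star (p.coeff (d, -k)) = 0

/-- The analogue of `KillsA` for the coefficient matrices that belong to `b ^ (-e)`. -/
def KillsB (p q : BiLaurent) (e : ℕ) (x y : ℂ) : Prop :=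
  ∀ j : ℤ, x * p.coeff (j, -e) - y * star (q.coeff (-j, e)) = 0 ∧
    x * q.coeff (j, -e) + y * star (p.coeff (-j, e)) = 0

/-- The element of `SU(2)` whose inverse has the first row `(x, y)`. -/
def suMatrix (x y : ℂ) (h : x * star x + y * star y = 1) :
    Matrix.specialUnitaryGroup (Fin 2) ℂ :=
  ⟨!![star x, -y; star y, x], by
    rw [Matrix.mem_specialUnitaryGroup_iff, Matrix.mem_unitaryGroup_iff]
    constructor
    · ext i j
      fin_cases i <;> fin_cases j <;>
        simp [Matrix.mul_apply, Fin.sum_univ_two] <;> simp at h <;>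
        first | linear_combination h | ring
    · simp [Matrix.det_fin_two]; simp at h; linear_combination h⟩

theorem exists_normalize (x y : ℂ) (h : x ≠ 0 ∨ y ≠ 0) :
    ∃ c : ℂ, c ≠ 0 ∧ (c * x) * star (c * x) + (c * y) * star (c * y) = 1 := by
  have hpos : 0 < Complex.normSq x + Complex.normSq y := by
    rcases h with h | h
    · have := Complex.normSq_pos.2 h; have := Complex.normSq_nonneg y; positivity
    · have := Complex.normSq_pos.2 h; have := Complex.normSq_nonneg x; positivity
  set n := Complex.normSq x + Complex.normSq y with hn
  have hs : (Real.sqrt n)⁻¹ * (Real.sqrt n)⁻¹ * n = 1 := by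
    rw [← mul_inv, Real.mul_self_sqrt hpos.le, inv_mul_cancel₀ hpos.ne']
  refine ⟨((Real.sqrt n)⁻¹ : ℝ), by simpa using (Real.sqrt_pos.2 hpos).ne', ?_⟩
  have hs' : (((Real.sqrt n)⁻¹ : ℝ) : ℂ) * (((Real.sqrt n)⁻¹ : ℝ) : ℂ) * (n : ℂ) = 1 := by
    exact_mod_cast congrArg ((↑) : ℝ → ℂ) hs
  have hx : x * star x + y * star y = (n : ℂ) := by
    simp [hn, Complex.mul_conj]
  simp only [star_mul', Complex.star_def, Complex.conj_ofReal] at hx ⊢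
  linear_combination hs' + (((Real.sqrt n)⁻¹ : ℝ) : ℂ) * (((Real.sqrt n)⁻¹ : ℝ) : ℂ) * hx

/-- Writes a quaternionic matrix as `U * diag(n, m) * G`, where `G = diag(m, n) * U⁻¹ * F` and
`n = m⁻¹`; primes stand for adjoints. -/
theorem quaternion_factor {R : Type*} [CommRing R] {x y x' y' m n : R}
    (hxy : x * x' + y * y' = 1) (hm : m * n = 1) (p q p' q' : R) :
    !![p, q; -q', p'] = !![x', -y; y', x] * !![n, 0; 0, m] *
      !![m * (x * p - y * q'), m * (x * q + y * p');
        -(n * (x' * q' + y' * p)), n * (x' * p' - y' * q)] := by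
  rw [Matrix.mul_fin_two, Matrix.mul_fin_two]
  congr! 2
  · congr! 1
    · linear_combination (-p) * hxy - (x' * (x * p - y * q') + y * (x' * q' + y' * p)) * hm
    · congr! 1
      linear_combination (-q) * hxy - (x' * (x * q + y * p') - y * (x' * p' - y' * q)) * hm
  · congr! 2
    · linear_combination q' * hxy - (y' * (x * p - y * q') - x * (x' * q' + y' * p)) * hm
    · congr! 1
      linear_combination (-p') * hxy - (y' * (x * q + y * p') + x * (x' * p' - y' * q)) * hm

/-- With `U ∈ SU(2)` such that `U⁻¹` has the first row `(x, y)`, the first row of `U⁻¹ F` has no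
term `a ^ (-(d + 1))`, so its exponents lie between `-(d - 1)` and `d + 1` by parity. Multiplying
by `a⁻¹` centres them and lowers the degree by one; the second row follows by adjunction. -/
theorem IsQSP.peelA_of_norm {p q : BiLaurent} {d e : ℕ} (h : IsQSP p q (d + 1) e) {x y : ℂ}
    (hxy : x * star x + y * star y = 1) (hk : KillsA p q (d + 1) x y) :
    ∃ p' q' : BiLaurent, IsQSP p' q' d e ∧
      quatMat p q = constMat (suMatrix x y hxy).1 * signal Var.a * quatMat p' q' := by
  set X := algebraMap ℂ BiLaurent x with hX
  set Y := algebraMap ℂ BiLaurent y with hY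
  set X' := algebraMap ℂ BiLaurent (star x) with hX'
  set Y' := algebraMap ℂ BiLaurent (star y) with hY'
  have hXY : X * X' + Y * Y' = 1 := by
    rw [hX, hX', hY, hY', ← map_mul, ← map_mul, ← map_add, hxy, map_one]
  have hm : mono (-1) 0 * mono 1 0 = 1 := by
    rw [mono_mul_mono]; exact mono_zero
  have hdp : dag (mono (-1) 0 * (X * p - Y * dag q)) = mono 1 0 * (X' * dag p - Y' * q) := by
    simp only [hX, hY, hX', hY', map_mul, map_sub, dag_algebraMap, dag_mono, dag_dag,
      neg_neg, neg_zero]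
  have hdq : dag (mono (-1) 0 * (X * q + Y * dag p)) = mono 1 0 * (X' * dag q + Y' * p) := by
    simp only [hX, hY, hX', hY', map_mul, map_add, dag_algebraMap, dag_mono, dag_dag,
      neg_neg, neg_zero]
  have hcp : ∀ m : ℤ × ℤ, (mono (-1) 0 * (X * p - Y * dag q)).coeff m =
      x * p.coeff (m.1 + 1, m.2) - y * star (q.coeff (-(m.1 + 1), -m.2)) := by
    intro m
    rw [coeff_mono_mul, hX, hY, ← Algebra.smul_def, ← Algebra.smul_def]
    have : m - (-1, 0) = (m.1 + 1, m.2) := by ext <;> simp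
    rw [this]
    simp [coeff_dag]
  have hcq : ∀ m : ℤ × ℤ, (mono (-1) 0 * (X * q + Y * dag p)).coeff m =
      x * q.coeff (m.1 + 1, m.2) + y * star (p.coeff (-(m.1 + 1), -m.2)) := by
    intro m
    rw [coeff_mono_mul, hX, hY, ← Algebra.smul_def, ← Algebra.smul_def]
    have : m - (-1, 0) = (m.1 + 1, m.2) := by ext <;> simp
    rw [this]
    simp [coeff_dag]
  have hbox : ∀ m : ℤ × ℤ, ∀ r s : BiLaurent, ∀ c c' : ℂ,
      SupportedInBox (d + 1) e r →
      SupportedInBox (d + 1) e s →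
      c * r.coeff (m.1 + 1, m.2) + c' * star (s.coeff (-(m.1 + 1), -m.2)) ≠ 0 →
      (m.1 + 1 = -(d + 1 : ℕ) →
        c * r.coeff (m.1 + 1, m.2) + c' * star (s.coeff (-(m.1 + 1), -m.2)) = 0) →
      |m.1| ≤ d ∧ |m.2| ≤ e ∧ (m.1 - d) % 2 = 0 ∧ (m.2 - e) % 2 = 0 := by
    rintro ⟨j, k⟩ r s c c' hr hs hne hz
    -- excluding `-(d + 1)` leaves `-(d - 1) ≤ j + 1 ≤ d + 1` by parity
    have hj : j + 1 ≠ -(d + 1 : ℕ) := fun hj => hne (hz hj)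
    by_cases h0 : r.coeff (j + 1, k) = 0
    · by_cases h1 : s.coeff (-(j + 1), -k) = 0
      · exact absurd (by simp only [h0, h1, star_zero, mul_zero, add_zero]) hne
      · have := hs _ h1
        simp only [abs_le] at this ⊢
        push_cast at *
        omega
    · have := hr _ h0
      simp only [abs_le] at this ⊢
      push_cast at *
      omega
  refine ⟨mono (-1) 0 * (X * p - Y * dag q), mono (-1) 0 * (X * q + Y * dag p),
    ⟨?_, fun m hm => ?_, fun m hm => ?_⟩, ?_⟩
  · rw [hdp, hdq]
    linear_combination ((X * p - Y * dag q) * (X' * dag p - Y' * q) +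
      (X * q + Y * dag p) * (X' * dag q + Y' * p)) * hm + (X * X' + Y * Y') * h.norm + hXY
  · rw [hcp] at hm
    refine hbox m p q x (-y) h.supp_left h.supp_right (by convert hm using 1; ring) fun hj => ?_
    rw [hj]
    have := (hk m.2).1
    rw [neg_neg]
    linear_combination this
  · rw [hcq] at hm
    refine hbox m q p x y h.supp_right h.supp_left hm fun hj => ?_
    rw [hj]
    have := (hk m.2).2
    rw [neg_neg]
    linear_combination this
  · have hU : constMat (suMatrix x y hxy).1 = !![X', -Y; Y', X] := by
      ext i j : 1
      fin_cases i <;> fin_cases j <;> simp only [constMat, suMatrix, Matrix.map_apply] <;>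
        simp [hX, hX', hY, hY']
    rw [hU, quatMat_eq, quatMat_eq, hdp, hdq]
    exact quaternion_factor hXY hm p q (dag p) (dag q)

theorem IsQSP.peelA {p q : BiLaurent} {d e : ℕ} (h : IsQSP p q (d + 1) e) {x y : ℂ}
    (hxy : x ≠ 0 ∨ y ≠ 0) (hk : KillsA p q (d + 1) x y) :
    ∃ (U : Matrix.specialUnitaryGroup (Fin 2) ℂ) (p' q' : BiLaurent), IsQSP p' q' d e ∧
      quatMat p q = constMat U.1 * signal Var.a * quatMat p' q' := by
  obtain ⟨c, -, hc⟩ := exists_normalize x y hxy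
  refine ⟨suMatrix _ _ hc, h.peelA_of_norm hc fun k => ⟨?_, ?_⟩⟩
  · linear_combination c * (hk k).1
  · linear_combination c * (hk k).2

theorem IsQSP.decomposition_of_killsA {p q : BiLaurent} {d e : ℕ} (h : IsQSP p q (d + 1) e)
    {x y : ℂ} (hxy : x ≠ 0 ∨ y ≠ 0) (hk : KillsA p q (d + 1) x y)
    (ih : ∀ p' q', IsQSP p' q' d e → HasProductDecomposition (quatMat p' q')) :
    HasProductDecomposition (quatMat p q) := by
  obtain ⟨U, p', q', h', heq⟩ := h.peelA hxy hk
  rw [heq]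
  exact (ih _ _ h').cons U Var.a

theorem HasProductDecomposition.of_swap {p q : BiLaurent}
    (h : HasProductDecomposition (quatMat (swapVars p) (swapVars q))) :
    HasProductDecomposition (quatMat p q) := by
  simpa [quatMat_map_swapVars] using h.map_swapVars

theorem IsQSP.decomposition_of_killsB {p q : BiLaurent} {d e : ℕ} (h : IsQSP p q d (e + 1))
    {x y : ℂ} (hxy : x ≠ 0 ∨ y ≠ 0) (hk : KillsB p q (e + 1) x y)
    (ih : ∀ p' q', IsQSP p' q' d e → HasProductDecomposition (quatMat p' q')) :
    HasProductDecomposition (quatMat p q) := by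
  refine .of_swap (h.swap.decomposition_of_killsA hxy (fun k => ?_) fun p' q' h' =>
    .of_swap (ih _ _ h'.swap))
  simpa [coeff_swapVars] using hk k

/-! ### Homogeneous parts in `b` and the vectors that allow peeling -/

/-- Every monomial of `p` has the exponent `k` in `b`. For `k = 0` this says that `p` is a Laurent
polynomial in `a` alone. -/
def IsHomogB (k : ℤ) (p : BiLaurent) : Prop := ∀ m, p.coeff m ≠ 0 → m.2 = k

theorem exists_coeff_of_coeff_mul_ne_zero {p q : BiLaurent} {m : ℤ × ℤ}
    (h : (p * q).coeff m ≠ 0) :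
    ∃ m₁ m₂, p.coeff m₁ ≠ 0 ∧ q.coeff m₂ ≠ 0 ∧ m₁ + m₂ = m := by
  have := AddMonoidAlgebra.support_coeff_mul_subset p q (Finsupp.mem_support_iff.2 h)
  obtain ⟨m₁, h₁, m₂, h₂, rfl⟩ := Finset.mem_add.1 this
  exact ⟨m₁, m₂, Finsupp.mem_support_iff.1 h₁, Finsupp.mem_support_iff.1 h₂, rfl⟩

theorem IsHomogB.mul {k l : ℤ} {p q : BiLaurent} (hp : IsHomogB k p) (hq : IsHomogB l q) :
    IsHomogB (k + l) (p * q) := by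
  intro m hm
  obtain ⟨m₁, m₂, h₁, h₂, rfl⟩ := exists_coeff_of_coeff_mul_ne_zero hm
  simp [hp _ h₁, hq _ h₂]

theorem IsHomogB.add {k : ℤ} {p q : BiLaurent} (hp : IsHomogB k p) (hq : IsHomogB k q) :
    IsHomogB k (p + q) := by
  intro m hm
  by_contra hk
  have h₁ : p.coeff m = 0 := by_contra fun h => hk (hp m h)
  have h₂ : q.coeff m = 0 := by_contra fun h => hk (hq m h)
  simp [h₁, h₂] at hm

theorem IsHomogB.neg {k : ℤ} {p : BiLaurent} (hp : IsHomogB k p) : IsHomogB k (-p) :=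
  fun m hm => hp m (by simpa using hm)

theorem IsHomogB.sub {k : ℤ} {p q : BiLaurent} (hp : IsHomogB k p) (hq : IsHomogB k q) :
    IsHomogB k (p - q) := sub_eq_add_neg p q ▸ hp.add hq.neg

theorem IsHomogB.dag {k : ℤ} {p : BiLaurent} (hp : IsHomogB k p) : IsHomogB (-k) (dag p) := by
  intro m hm
  rw [coeff_dag, star_ne_zero] at hm
  have := hp _ hm
  simp only [Prod.snd_neg] at this
  omega

theorem isHomogB_algebraMap (c : ℂ) : IsHomogB 0 (algebraMap ℂ BiLaurent c) := by
  intro m hm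
  rw [coeff_algebraMap] at hm
  by_contra h
  exact hm (if_neg fun h' => h (by rw [h']; rfl))

theorem isHomogB_one : IsHomogB 0 (1 : BiLaurent) := by
  rw [← map_one (algebraMap ℂ BiLaurent)]
  exact isHomogB_algebraMap 1

theorem eq_zero_of_isHomogB {k l n : ℤ} {u v w : BiLaurent} (hu : IsHomogB k u)
    (hv : IsHomogB l v) (hw : IsHomogB n w) (hkl : k ≠ l) (hkn : k ≠ n) (hln : l ≠ n)
    (h : u + v + w = 0) : u = 0 ∧ v = 0 ∧ w = 0 := by
  have key : ∀ m, u.coeff m = 0 ∧ v.coeff m = 0 ∧ w.coeff m = 0 := by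
    intro m
    have hs : u.coeff m + v.coeff m + w.coeff m = 0 := by
      simpa using congrArg (fun p : BiLaurent => p.coeff m) h
    have h₁ := hu m
    have h₂ := hv m
    have h₃ := hw m
    by_cases a : u.coeff m = 0 <;> by_cases b : v.coeff m = 0 <;>
      by_cases c : w.coeff m = 0 <;> simp_all
  exact ⟨AddMonoidAlgebra.ext (Finsupp.ext fun m => (key m).1),
    AddMonoidAlgebra.ext (Finsupp.ext fun m => (key m).2.1),
    AddMonoidAlgebra.ext (Finsupp.ext fun m => (key m).2.2)⟩

/-- The part of `p` consisting of the monomials with the exponent `k` in `b`. -/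
def partB (k : ℤ) (p : BiLaurent) : BiLaurent := .ofCoeff (p.coeff.filter fun m => m.2 = k)

theorem coeff_partB (k : ℤ) (p : BiLaurent) (m : ℤ × ℤ) :
    (partB k p).coeff m = if m.2 = k then p.coeff m else 0 := by
  simp [partB, Finsupp.filter_apply]

theorem isHomogB_partB (k : ℤ) (p : BiLaurent) : IsHomogB k (partB k p) := by
  intro m hm
  rw [coeff_partB] at hm
  by_contra h
  exact hm (if_neg h)

/-- The lowest coefficient in `a` of a product is the product of the lowest coefficients, if the
first factor does not involve `b`. -/
theorem coeff_mul_lowest {X p : BiLaurent} {j n : ℤ} (hX : IsHomogB 0 X)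
    (hXj : ∀ m, X.coeff m ≠ 0 → j ≤ m.1) (hp : ∀ m, p.coeff m ≠ 0 → n ≤ m.1) (k : ℤ) :
    (X * p).coeff (j + n, k) = X.coeff (j, 0) * p.coeff (n, k) := by
  have := AddMonoidAlgebra.coeff_mul_add_of_uniqueAdd (f := X) (g := p) (a0 := (j, 0))
    (b0 := (n, k)) ?_
  · simpa using this
  · intro m₁ m₂ h₁ h₂ h
    rw [Finsupp.mem_support_iff] at h₁ h₂
    have h0 := hX _ h₁
    have h1 := hXj _ h₁
    have h2 := hp _ h₂
    simp only [Prod.ext_iff, Prod.fst_add, Prod.snd_add] at h ⊢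
    omega

/-- If the row `(X, Y)` of polynomials in `a` has negative exponents, but its product with
`quatMat p q` has no exponents below `-d`, then the lowest coefficient of `(X, Y)` annihilates the
coefficient matrices of `a ^ (-d)`. -/
theorem exists_killsA {p q X Y : BiLaurent} {d : ℕ}
    (hp : ∀ m, p.coeff m ≠ 0 → |m.1| ≤ d) (hq : ∀ m, q.coeff m ≠ 0 → |m.1| ≤ d)
    (hX : IsHomogB 0 X) (hY : IsHomogB 0 Y)
    (h₁ : ∀ m, (X * p - Y * dag q).coeff m ≠ 0 → -(d : ℤ) ≤ m.1)
    (h₂ : ∀ m, (X * q + Y * dag p).coeff m ≠ 0 → -(d : ℤ) ≤ m.1)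
    (hneg : ∃ m : ℤ × ℤ, m.1 < 0 ∧ (X.coeff m ≠ 0 ∨ Y.coeff m ≠ 0)) :
    ∃ x y : ℂ, (x ≠ 0 ∨ y ≠ 0) ∧ KillsA p q d x y := by
  classical
  obtain ⟨m₀, hm₀, hm₀'⟩ := hneg
  obtain ⟨⟨j, k₀⟩, hm, hmin⟩ := (X.coeff.support ∪ Y.coeff.support).exists_min_image
    (fun m => m.1) ⟨m₀, by simpa using hm₀'⟩
  have hj : j < 0 := (hmin m₀ (by simpa using hm₀')).trans_lt hm₀
  simp only [Finset.mem_union, Finsupp.mem_support_iff] at hm hmin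
  have hk₀ : k₀ = 0 := hm.elim (hX _) (hY _)
  subst hk₀
  have low : ∀ r : BiLaurent, (∀ m, r.coeff m ≠ 0 → |m.1| ≤ d) →
      (∀ m, r.coeff m ≠ 0 → -(d : ℤ) ≤ m.1) ∧ ∀ m, (dag r).coeff m ≠ 0 → -(d : ℤ) ≤ m.1 := by
    intro r hr
    refine ⟨fun m hm => (abs_le.1 (hr m hm)).1, fun m hm => ?_⟩
    rw [coeff_dag, star_ne_zero] at hm
    have := (abs_le.1 (hr _ hm)).2
    simp only [Prod.fst_neg] at this
    omega
  have hXj := fun m hm => hmin m (Or.inl hm)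
  have hYj := fun m hm => hmin m (Or.inr hm)
  refine ⟨X.coeff (j, 0), Y.coeff (j, 0), hm, fun k => ⟨?_, ?_⟩⟩
  · have : (X * p - Y * dag q).coeff (j + -d, k) = 0 := by
      by_contra h
      have := h₁ _ h
      simp only at this
      omega
    rw [← this, AddMonoidAlgebra.coeff_sub, Finsupp.sub_apply, coeff_mul_lowest hX hXj (low p hp).1,
      coeff_mul_lowest hY hYj (low q hq).2, coeff_dag]
    simp
  · have : (X * q + Y * dag p).coeff (j + -d, k) = 0 := by
      by_contra h
      have := h₂ _ h
      simp only at this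
      omega
    rw [← this, AddMonoidAlgebra.coeff_add, Finsupp.add_apply, coeff_mul_lowest hX hXj (low q hq).1,
      coeff_mul_lowest hY hYj (low p hp).2, coeff_dag]
    simp

/-- A Laurent polynomial in `a` without negative exponents, whose adjoint has none either, is
constant. -/
theorem exists_algebraMap_of_dag_nonneg {X : BiLaurent} (hX : IsHomogB 0 X)
    (h : ∀ m : ℤ × ℤ, m.1 < 0 → X.coeff m = 0) (h' : ∀ m : ℤ × ℤ, m.1 < 0 → (dag X).coeff m = 0) :
    ∃ x : ℂ, X = algebraMap ℂ BiLaurent x := by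
  refine ⟨X.coeff 0, ?_⟩
  ext m
  rw [coeff_algebraMap]
  split_ifs with hm
  · rw [hm]
  · by_contra hne
    have h2 := hX m hne
    rcases lt_trichotomy m.1 0 with h0 | h0 | h0
    · exact hne (h m h0)
    · exact hm (Prod.ext h0 h2)
    · have := h' (-m) (by simpa using h0)
      rw [coeff_dag, neg_neg, star_eq_zero] at this
      exact hne this

/-- Write `quatMat p q = A + B` with the parts of exponent `1` and `-1` in `b`. Then `P = A A†` is
a self-adjoint projection with `P A = A` and `P B = 0`. If `P` depends on `a`, the lowest
coefficient of one of its rows annihilates the `a ^ (-d)` coefficients of `A` and of `B`; if `P`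
is constant, one of its rows annihilates `B`, which is the coefficient of `b⁻¹`. -/
theorem IsQSP.killsA_or_killsB {p q : BiLaurent} {d : ℕ} (h : IsQSP p q d 1) :
    ∃ x y : ℂ, (x ≠ 0 ∨ y ≠ 0) ∧ (KillsA p q d x y ∨ KillsB p q 1 x y) := by
  obtain ⟨p₁, hp₁⟩ : ∃ r, r = partB 1 p := ⟨_, rfl⟩
  obtain ⟨p₂, hp₂⟩ : ∃ r, r = partB (-1) p := ⟨_, rfl⟩
  obtain ⟨q₁, hq₁⟩ : ∃ r, r = partB 1 q := ⟨_, rfl⟩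
  obtain ⟨q₂, hq₂⟩ : ∃ r, r = partB (-1) q := ⟨_, rfl⟩
  have split : ∀ r : BiLaurent, SupportedInBox d 1 r →
      r = partB 1 r + partB (-1) r := by
    intro r hr
    ext m
    rw [AddMonoidAlgebra.coeff_add, Finsupp.add_apply, coeff_partB, coeff_partB]
    by_cases h0 : r.coeff m = 0
    · simp [h0]
    · have := hr m h0
      simp only [abs_le] at this
      have : m.2 = 1 ∨ m.2 = -1 := by omega
      rcases this with h | h <;> simp [h]
  have ep : p = p₁ + p₂ := hp₁ ▸ hp₂ ▸ split p h.supp_left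
  have eq : q = q₁ + q₂ := hq₁ ▸ hq₂ ▸ split q h.supp_right
  have hhp₁ : IsHomogB 1 p₁ := hp₁ ▸ isHomogB_partB _ _
  have hhp₂ : IsHomogB (-1) p₂ := hp₂ ▸ isHomogB_partB _ _
  have hhq₁ : IsHomogB 1 q₁ := hq₁ ▸ isHomogB_partB _ _
  have hhq₂ : IsHomogB (-1) q₂ := hq₂ ▸ isHomogB_partB _ _
  have hnorm := h.norm
  rw [ep, eq] at hnorm
  simp only [map_add] at hnorm
  -- the parts of exponent `2`, `0`, `-2` in `b` of the determinant equation
  obtain ⟨R1, R3, R2⟩ := eq_zero_of_isHomogB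
    (u := p₁ * dag p₂ + q₁ * dag q₂)
    (v := p₁ * dag p₁ + p₂ * dag p₂ + (q₁ * dag q₁ + q₂ * dag q₂) - 1)
    (w := p₂ * dag p₁ + q₂ * dag q₁)
    ((hhp₁.mul hhp₂.dag).add (hhq₁.mul hhq₂.dag))
    ((((hhp₁.mul hhp₁.dag).add (hhp₂.mul hhp₂.dag)).add
      ((hhq₁.mul hhq₁.dag).add (hhq₂.mul hhq₂.dag))).sub isHomogB_one)
    ((hhp₂.mul hhp₁.dag).add (hhq₂.mul hhq₁.dag))
    (by norm_num) (by norm_num) (by norm_num) (by linear_combination hnorm)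
  -- the projection `P` has the rows `(X, Y)` and `(dag Y, 1 - X)`
  obtain ⟨X, hX⟩ : ∃ X, X = p₁ * dag p₁ + q₁ * dag q₁ := ⟨_, rfl⟩
  obtain ⟨Y, hY⟩ : ∃ Y, Y = q₁ * p₂ - p₁ * q₂ := ⟨_, rfl⟩
  have hXX : dag X = X := by rw [hX]; simp only [map_add, map_mul, dag_dag]; ring
  have hYY : dag Y = dag q₁ * dag p₂ - dag p₁ * dag q₂ := by rw [hY]; simp only [map_sub, map_mul]
  have hhX : IsHomogB 0 X := hX ▸ (hhp₁.mul hhp₁.dag).add (hhq₁.mul hhq₁.dag)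
  have hhY : IsHomogB 0 Y := hY ▸ (hhq₁.mul hhp₂).sub (hhp₁.mul hhq₂)
  have hhYd : IsHomogB 0 (dag Y) := hhY.dag
  have hsp : ∀ m, p.coeff m ≠ 0 → |m.1| ≤ d := fun m hm => (h.supp_left m hm).1
  have hsq : ∀ m, q.coeff m ≠ 0 → |m.1| ≤ d := fun m hm => (h.supp_right m hm).1
  have low : ∀ r : BiLaurent, (∀ m, r.coeff m ≠ 0 → |m.1| ≤ d) → ∀ k m,
      ((partB k r).coeff m ≠ 0 → -(d : ℤ) ≤ m.1) ∧
      ((dag (partB k r)).coeff m ≠ 0 → -(d : ℤ) ≤ m.1) := by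
    intro r hr k m
    constructor <;> intro hm
    · rw [coeff_partB] at hm
      split_ifs at hm
      · exact (abs_le.1 (hr _ hm)).1
      · exact absurd rfl hm
    · rw [coeff_dag, star_ne_zero, coeff_partB] at hm
      split_ifs at hm
      · have := (abs_le.1 (hr _ hm)).2
        simp only [Prod.fst_neg] at this
        omega
      · exact absurd rfl hm
  -- `P (A + B) = A`, entry by entry
  have e1 : X * p - Y * dag q = p₁ := by
    rw [hX, hY, ep, eq]; simp only [map_add]
    linear_combination p₁ * R3 - p₂ * R1 + p₁ * R2
  have e2 : X * q + Y * dag p = q₁ := by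
    rw [hX, hY, ep, eq]; simp only [map_add]
    linear_combination q₁ * R3 - q₂ * R1 + q₁ * R2
  have e3 : dag Y * p - (1 - X) * dag q = -dag q₂ := by
    rw [hYY, hX, ep, eq]; simp only [map_add]
    linear_combination dag q₁ * R1 + dag q₁ * R3 - dag q₂ * R2
  have e4 : dag Y * q + (1 - X) * dag p = dag p₂ := by
    rw [hYY, hX, ep, eq]; simp only [map_add]
    linear_combination (-dag p₁) * R1 - dag p₁ * R3 + dag p₂ * R2
  by_cases hneg : ∃ m : ℤ × ℤ, m.1 < 0 ∧ (X.coeff m ≠ 0 ∨ Y.coeff m ≠ 0)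
  · obtain ⟨x, y, hxy, hk⟩ := exists_killsA hsp hsq hhX hhY
      (by rw [e1, hp₁]; exact fun m => (low p hsp 1 m).1)
      (by rw [e2, hq₁]; exact fun m => (low q hsq 1 m).1) hneg
    exact ⟨x, y, hxy, Or.inl hk⟩
  by_cases hneg' : ∃ m : ℤ × ℤ, m.1 < 0 ∧ (dag Y).coeff m ≠ 0
  · obtain ⟨x, y, hxy, hk⟩ := exists_killsA hsp hsq hhYd (isHomogB_one.sub hhX)
      (by
        rw [e3, hq₂]
        exact fun m hm => (low q hsq (-1) m).2 (by simpa using hm))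
      (by rw [e4, hp₂]; exact fun m => (low p hsp (-1) m).2)
      (hneg'.imp fun m hm => ⟨hm.1, Or.inl hm.2⟩)
    exact ⟨x, y, hxy, Or.inl hk⟩
  push Not at hneg hneg'
  obtain ⟨x, hx⟩ := exists_algebraMap_of_dag_nonneg hhX (fun m hm => (hneg m hm).1)
    (by rw [hXX]; exact fun m hm => (hneg m hm).1)
  obtain ⟨y, hy⟩ := exists_algebraMap_of_dag_nonneg hhY (fun m hm => (hneg m hm).2) hneg'
  -- `P B = 0`, entry by entry
  have f1 : X * p₂ - Y * dag q₁ = 0 := by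
    rw [hX, hY]; linear_combination p₁ * R2
  have f2 : X * q₂ + Y * dag p₁ = 0 := by
    rw [hX, hY]; linear_combination q₁ * R2
  have f3 : dag Y * p₂ - (1 - X) * dag q₁ = 0 := by
    rw [hYY, hX]; linear_combination dag q₁ * R3 - dag q₂ * R2
  have f4 : dag Y * q₂ + (1 - X) * dag p₁ = 0 := by
    rw [hYY, hX]; linear_combination (-dag p₁) * R3 + dag p₂ * R2
  have killsB : ∀ u v : ℂ, algebraMap ℂ BiLaurent u * p₂ - algebraMap ℂ BiLaurent v * dag q₁ = 0 →
      algebraMap ℂ BiLaurent u * q₂ + algebraMap ℂ BiLaurent v * dag p₁ = 0 →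
      KillsB p q 1 u v := by
    intro u v h1 h2 j
    rw [← Algebra.smul_def, ← Algebra.smul_def] at h1 h2
    have h1' := congrArg (fun r : BiLaurent => r.coeff (j, -1)) h1
    have h2' := congrArg (fun r : BiLaurent => r.coeff (j, -1)) h2
    simp [hp₁, hp₂, hq₁, hq₂, coeff_dag, coeff_partB] at h1' h2'
    exact ⟨by simpa using h1', by simpa using h2'⟩
  by_cases hxy : x ≠ 0 ∨ y ≠ 0
  · exact ⟨x, y, hxy, Or.inr (killsB x y (hx ▸ hy ▸ f1) (hx ▸ hy ▸ f2))⟩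
  · push Not at hxy
    rw [hxy.1, map_zero] at hx
    rw [hxy.2, map_zero] at hy
    refine ⟨0, 1, Or.inr one_ne_zero, Or.inr (killsB 0 1 ?_ ?_)⟩
    · simpa [hx, hy] using f3
    · simpa [hx, hy] using f4

/-! ### Products with at most one factor in `b`, and unitarity on the torus -/

/-- The coefficient matrix of `a ^ (-(d + 1))` is singular, since its determinant is the
coefficient of `a ^ (-2 (d + 1))` in the constant determinant one. -/
theorem IsQSP.exists_killsA_of_succ_zero {p q : BiLaurent} {d : ℕ} (h : IsQSP p q (d + 1) 0) :
    ∃ x y : ℂ, (x ≠ 0 ∨ y ≠ 0) ∧ KillsA p q (d + 1) x y := by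
  have hk : ∀ r : BiLaurent, SupportedInBox (d + 1) 0 r → IsHomogB 0 r := by
    intro r hr m hm
    simpa using (hr m hm).2.1
  have hp := hk p h.supp_left
  have hq := hk q h.supp_right
  have low : ∀ r : BiLaurent, SupportedInBox (d + 1) 0 r →
      (∀ m, r.coeff m ≠ 0 → -((d + 1 : ℕ) : ℤ) ≤ m.1) ∧
      ∀ m, (dag r).coeff m ≠ 0 → -((d + 1 : ℕ) : ℤ) ≤ m.1 := by
    intro r hr
    refine ⟨fun m hm => (abs_le.1 (hr m hm).1).1, fun m hm => ?_⟩
    rw [coeff_dag, star_ne_zero] at hm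
    have := (abs_le.1 (hr _ hm).1).2
    simp only [Prod.fst_neg] at this
    omega
  have hdet : p.coeff (-(d + 1 : ℕ), 0) * star (p.coeff ((d + 1 : ℕ), 0)) +
      q.coeff (-(d + 1 : ℕ), 0) * star (q.coeff ((d + 1 : ℕ), 0)) = 0 := by
    have := congrArg (fun r : BiLaurent => r.coeff (-(d + 1 : ℕ) + -(d + 1 : ℕ), 0)) h.norm
    simp only [AddMonoidAlgebra.coeff_add, Finsupp.add_apply] at this
    rw [coeff_mul_lowest hp (low p h.supp_left).1 (low p h.supp_left).2,
      coeff_mul_lowest hq (low q h.supp_right).1 (low q h.supp_right).2, coeff_dag, coeff_dag,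
      ← map_one (algebraMap ℂ BiLaurent), coeff_algebraMap, if_neg] at this
    · simpa using this
    · intro h0
      have := congrArg Prod.fst h0
      simp only [Prod.fst_zero] at this
      omega
  have hzero : ∀ r : BiLaurent, IsHomogB 0 r → ∀ m : ℤ × ℤ, m.2 ≠ 0 → r.coeff m = 0 :=
    fun r hr m hm => by_contra fun h => hm (hr m h)
  have kills : ∀ x y : ℂ,
      x * p.coeff (-(d + 1 : ℕ), 0) - y * star (q.coeff ((d + 1 : ℕ), 0)) = 0 →
      x * q.coeff (-(d + 1 : ℕ), 0) + y * star (p.coeff ((d + 1 : ℕ), 0)) = 0 →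
      KillsA p q (d + 1) x y := by
    intro x y h1 h2 k
    by_cases hk : k = 0
    · subst hk
      rw [neg_zero]
      exact ⟨h1, h2⟩
    · have hk' : -k ≠ 0 := by simpa using hk
      rw [hzero p hp (_, k) hk, hzero q hq (_, k) hk, hzero p hp (_, -k) hk',
        hzero q hq (_, -k) hk']
      simp
  -- a nonzero row of the adjugate of the singular coefficient matrix, if there is one
  by_cases h1 : star (q.coeff ((d + 1 : ℕ), 0)) ≠ 0 ∨ p.coeff (-(d + 1 : ℕ), 0) ≠ 0
  · exact ⟨_, _, h1, kills _ _ (by ring) (by linear_combination hdet)⟩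
  · push Not at h1
    by_cases h2 : star (p.coeff ((d + 1 : ℕ), 0)) ≠ 0 ∨ -q.coeff (-(d + 1 : ℕ), 0) ≠ 0
    · exact ⟨_, _, h2, kills _ _ (by linear_combination hdet) (by ring)⟩
    · push Not at h2
      refine ⟨1, 0, Or.inl one_ne_zero, kills _ _ (by rw [h1.2]; simp) ?_⟩
      rw [neg_eq_zero.1 h2.2]; simp

/-- In degree zero in `a` the condition `KillsA` concerns all coefficients, and the matrix is
invertible. -/
theorem IsQSP.not_killsA_zero {p q : BiLaurent} {e : ℕ} (h : IsQSP p q 0 e) {x y : ℂ}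
    (hxy : x ≠ 0 ∨ y ≠ 0) : ¬ KillsA p q 0 x y := by
  intro hk
  have hz : ∀ r : BiLaurent, SupportedInBox 0 e r → ∀ m : ℤ × ℤ, m.1 ≠ 0 → r.coeff m = 0 :=
    fun r hr m hm => by_contra fun h => hm (by simpa using (hr m h).1)
  have hp := hz p h.supp_left
  have hq := hz q h.supp_right
  have e1 : x • p - y • dag q = 0 := by
    ext ⟨j, k⟩
    by_cases hj : j = 0
    · subst hj; simpa [coeff_dag] using (hk k).1
    · have hj' : -j ≠ 0 := by simpa using hj
      simp [coeff_dag, hp (j, k) hj, hq (-j, -k) hj']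
  have e2 : x • q + y • dag p = 0 := by
    ext ⟨j, k⟩
    by_cases hj : j = 0
    · subst hj; simpa [coeff_dag] using (hk k).2
    · have hj' : -j ≠ 0 := by simpa using hj
      simp [coeff_dag, hq (j, k) hj, hp (-j, -k) hj']
  rw [Algebra.smul_def, Algebra.smul_def] at e1 e2
  have hx : algebraMap ℂ BiLaurent x = 0 := by
    linear_combination (-algebraMap ℂ BiLaurent x) * h.norm + dag p * e1 + dag q * e2
  have hy : algebraMap ℂ BiLaurent y = 0 := by
    linear_combination (-algebraMap ℂ BiLaurent y) * h.norm - q * e1 + p * e2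
  have inj : ∀ z : ℂ, algebraMap ℂ BiLaurent z = 0 → z = 0 := by
    intro z hz
    simpa [coeff_algebraMap] using congrArg (fun r : BiLaurent => r.coeff 0) hz
  exact hxy.elim (fun h => h (inj x hx)) fun h => h (inj y hy)

theorem IsQSP.decomposition_zero_zero {p q : BiLaurent} (h : IsQSP p q 0 0) :
    HasProductDecomposition (quatMat p q) := by
  have hconst : ∀ r : BiLaurent, SupportedInBox 0 0 r →
      r = algebraMap ℂ BiLaurent (r.coeff 0) := by
    intro r hr
    ext m
    rw [coeff_algebraMap]
    split_ifs with hm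
    · rw [hm]
    · by_contra h0
      have := hr m h0
      exact hm (Prod.ext (by simpa using this.1) (by simpa using this.2.1))
  obtain ⟨x, rfl⟩ : ∃ x, p = algebraMap ℂ BiLaurent x := ⟨_, hconst p h.supp_left⟩
  obtain ⟨y, rfl⟩ : ∃ x, q = algebraMap ℂ BiLaurent x := ⟨_, hconst q h.supp_right⟩
  have hn := h.norm
  rw [dag_algebraMap, dag_algebraMap, ← map_mul, ← map_mul, ← map_add] at hn
  have hn' := congrArg (fun r : BiLaurent => r.coeff 0) hn
  simp only [← map_one (algebraMap ℂ BiLaurent), coeff_algebraMap, if_true] at hn'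
  have : quatMat (algebraMap ℂ BiLaurent x) (algebraMap ℂ BiLaurent y) =
      constMat (suMatrix (star x) (-y) (by simp; simp at hn'; linear_combination hn')).1 := by
    ext i j : 1
    rw [quatMat_eq, dag_algebraMap, dag_algebraMap]
    fin_cases i <;> fin_cases j <;> simp [constMat, suMatrix]
  rw [this]
  exact hasProductDecomposition_constMat _

theorem IsQSP.decomposition_zero {p q : BiLaurent} {d : ℕ} (h : IsQSP p q d 0) :
    HasProductDecomposition (quatMat p q) := by
  induction d generalizing p q with
  | zero => exact h.decomposition_zero_zero
  | succ d ih =>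
    obtain ⟨x, y, hxy, hk⟩ := h.exists_killsA_of_succ_zero
    exact h.decomposition_of_killsA hxy hk fun _ _ => ih

theorem IsQSP.decomposition_one {p q : BiLaurent} {d : ℕ} (h : IsQSP p q d 1) :
    HasProductDecomposition (quatMat p q) := by
  induction d generalizing p q with
  | zero =>
    obtain ⟨x, y, hxy, hk | hk⟩ := h.killsA_or_killsB
    · exact absurd hk (h.not_killsA_zero hxy)
    · exact h.decomposition_of_killsB hxy hk fun _ _ h' => h'.decomposition_zero
  | succ d ih =>
    obtain ⟨x, y, hxy, hk | hk⟩ := h.killsA_or_killsB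
    · exact h.decomposition_of_killsA hxy hk fun _ _ => ih
    · exact h.decomposition_of_killsB hxy hk fun _ _ h' => h'.decomposition_zero

theorem IsQSP.decomposition_of_degB_le_one {p q : BiLaurent} {d e : ℕ} (h : IsQSP p q d e)
    (hp : ∀ m, p.coeff m ≠ 0 → |m.2| ≤ 1) (hq : ∀ m, q.coeff m ≠ 0 → |m.2| ≤ 1) :
    HasProductDecomposition (quatMat p q) := by
  have key : IsQSP p q d (e % 2) := by
    refine ⟨h.norm, fun m hm => ?_, fun m hm => ?_⟩
    · have h1 := h.supp_left m hm
      have h2 := hp m hm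
      simp only [abs_le] at h1 h2 ⊢
      omega
    · have h1 := h.supp_right m hm
      have h2 := hq m hm
      simp only [abs_le] at h1 h2 ⊢
      omega
  rcases Nat.mod_two_eq_zero_or_one e with h0 | h0 <;> rw [h0] at key
  · exact key.decomposition_zero
  · exact key.decomposition_one


theorem evalAt_mono (a b : ℂˣ) (j k : ℤ) : evalAt a b (mono j k) = (a : ℂ) ^ j * (b : ℂ) ^ k := by
  simp [evalAt, mono]

theorem evalAt_eq_sum (a b : ℂˣ) (p : BiLaurent) :
    evalAt a b p = ∑ m ∈ p.coeff.support, p.coeff m * ((a : ℂ) ^ m.1 * (b : ℂ) ^ m.2) := by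
  simp [evalAt, AddMonoidAlgebra.lift_apply, Finsupp.sum]

/-- The character `(a, b) ↦ a ^ j * b ^ k` of the torus. -/
def torusChar (m : ℤ × ℤ) : Circle × Circle →* ℂ where
  toFun z := (z.1 : ℂ) ^ m.1 * (z.2 : ℂ) ^ m.2
  map_one' := by simp
  map_mul' z w := by simp [mul_zpow]; ring

theorem torusChar_injective : Function.Injective torusChar := by
  have key : ∀ j k : ℤ, (∀ z : Circle, (z : ℂ) ^ j = (z : ℂ) ^ k) → j = k := by
    intro j k h
    -- `exp i` has infinite order on the circle because `π` is irrational
    have h1 := h (Circle.exp 1)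
    rw [← Circle.coe_zpow, ← Circle.coe_zpow, Circle.coe_inj, ← Circle.exp_zsmul,
      ← Circle.exp_zsmul, Circle.exp_eq_exp] at h1
    obtain ⟨n, hn⟩ := h1
    simp only [zsmul_eq_mul, mul_one] at hn
    by_contra hne
    have hn0 : n ≠ 0 := by
      rintro rfl
      exact hne (by simpa using hn)
    refine (irrational_pi.ratCast_mul (q := 2 * n) (by simpa using hn0)).ne_int (j - k) ?_
    push_cast
    linear_combination -hn
  intro m n h
  refine Prod.ext (key _ _ fun z => ?_) (key _ _ fun z => ?_)
  · simpa [torusChar] using DFunLike.congr_fun h (z, 1)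
  · simpa [torusChar] using DFunLike.congr_fun h (1, z)

/-- Dedekind's independence of characters, for finite trigonometric sums. -/
theorem coeff_eq_zero_of_torus {s : Finset (ℤ × ℤ)} {c : ℤ × ℤ → ℂ}
    (h : ∀ a b : Circle, ∑ m ∈ s, c m * ((a : ℂ) ^ m.1 * (b : ℂ) ^ m.2) = 0) :
    ∀ m ∈ s, c m = 0 := by
  have hli := (linearIndependent_monoidHom (Circle × Circle) ℂ).comp torusChar torusChar_injective
  rw [linearIndependent_iff'] at hli
  refine hli s c ?_
  ext ⟨a, b⟩
  simpa [torusChar] using h a b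

/-- A Laurent polynomial is determined by its values on the torus. -/
theorem ext_of_torus {p q : BiLaurent}
    (h : ∀ a b : Circle, evalAt (Circle.toUnits a) (Circle.toUnits b) p =
      evalAt (Circle.toUnits a) (Circle.toUnits b) q) : p = q := by
  rw [← sub_eq_zero]
  ext m
  by_contra hm
  refine hm (coeff_eq_zero_of_torus (s := (p - q).coeff.support) (fun a b => ?_) m
    (Finsupp.mem_support_iff.2 hm))
  have := evalAt_eq_sum (Circle.toUnits a) (Circle.toUnits b) (p - q)
  rw [map_sub, h, sub_self] at this
  exact this.symm

theorem evalAt_dag (a b : Circle) (p : BiLaurent) :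
    evalAt (Circle.toUnits a) (Circle.toUnits b) (dag p) =
      star (evalAt (Circle.toUnits a) (Circle.toUnits b) p) := by
  induction p using AddMonoidAlgebra.induction_linear with
  | zero => simp
  | add p q hp hq => rw [map_add, map_add, hp, hq, map_add, star_add]
  | single m c =>
    have : (single m c : BiLaurent) = c • mono m.1 m.2 := by simp [mono]
    rw [this, dag_smul, dag_mono, map_smul, map_smul, evalAt_mono, evalAt_mono]
    simp [← Circle.coe_inv_eq_conj]

theorem parityA_coeff {p : BiLaurent} {d : ℕ}
    (h : ∀ a b : ℂˣ, evalAt (-a) b p = (-1) ^ d * evalAt a b p) (m : ℤ × ℤ) (hm : p.coeff m ≠ 0) :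
    (m.1 - d) % 2 = 0 := by
  have key := coeff_eq_zero_of_torus (s := p.coeff.support)
    (c := fun m => p.coeff m * ((-1) ^ m.1 - (-1) ^ d)) (fun a b => ?_) m
    (Finsupp.mem_support_iff.2 hm)
  · have := (mul_eq_zero.1 key).resolve_left hm
    rw [sub_eq_zero, ← zpow_natCast] at this
    rw [← Int.even_iff, Int.even_sub]
    rcases Int.even_or_odd m.1 with h1 | h1 <;> rcases Int.even_or_odd (d : ℤ) with h2 | h2 <;>
      simp only [h1.neg_one_zpow, h2.neg_one_zpow] at this <;>
      first | tauto | (norm_num at this; done) |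
        (rw [← Int.not_even_iff_odd] at h1 h2; tauto)
  · have := h (Circle.toUnits a) (Circle.toUnits b)
    rw [evalAt_eq_sum, evalAt_eq_sum, ← sub_eq_zero, Finset.mul_sum, ← Finset.sum_sub_distrib]
      at this
    rw [← this]
    refine Finset.sum_congr rfl fun m _ => ?_
    have : ((-(Circle.toUnits a) : ℂˣ) : ℂ) ^ m.1 = (-1) ^ m.1 * (a : ℂ) ^ m.1 := by
      rw [← mul_zpow]; simp
    rw [this]
    simp only [Circle.toUnits_apply, Units.val_mk0]
    ring

theorem evalAt_swapVars (a b : ℂˣ) (p : BiLaurent) : evalAt a b (swapVars p) = evalAt b a p := by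
  induction p using AddMonoidAlgebra.induction_linear with
  | zero => simp
  | add p q hp hq => rw [map_add, map_add, hp, hq, map_add]
  | single m c =>
    have : (single m c : BiLaurent) = c • mono m.1 m.2 := by simp [mono]
    rw [this, Algebra.smul_def, map_mul, swapVars_algebraMap, swapVars_mono, map_mul, map_mul,
      evalAt_mono, evalAt_mono, AlgHom.commutes, AlgHom.commutes]
    ring

theorem parityB_coeff {p : BiLaurent} {e : ℕ}
    (h : ∀ a b : ℂˣ, evalAt a (-b) p = (-1) ^ e * evalAt a b p) (m : ℤ × ℤ) (hm : p.coeff m ≠ 0) :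
    (m.2 - e) % 2 = 0 := by
  refine parityA_coeff (p := swapVars p) (d := e) (fun a b => ?_) m.swap ?_
  · rw [evalAt_swapVars, evalAt_swapVars, h]
  · rwa [coeff_swapVars, Prod.swap_swap]

theorem le_matDegA (F : MatLaurent) (i j : Fin 2) (m : ℤ × ℤ) (hm : (F i j).coeff m ≠ 0) :
    m.1.natAbs ≤ matDegA F :=
  (Finset.le_sup (f := fun m : ℤ × ℤ => m.1.natAbs) (Finsupp.mem_support_iff.2 hm)).trans
    (Finset.le_sup (f := fun ij : Fin 2 × Fin 2 => degA (F ij.1 ij.2)) (Finset.mem_univ (i, j)))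

theorem le_matDegB (F : MatLaurent) (i j : Fin 2) (m : ℤ × ℤ) (hm : (F i j).coeff m ≠ 0) :
    m.2.natAbs ≤ matDegB F :=
  (Finset.le_sup (f := fun m : ℤ × ℤ => m.2.natAbs) (Finsupp.mem_support_iff.2 hm)).trans
    (Finset.le_sup (f := fun ij : Fin 2 × Fin 2 => degB (F ij.1 ij.2)) (Finset.mem_univ (i, j)))

theorem specialUnitaryGroup_relations {M : Matrix (Fin 2) (Fin 2) ℂ}
    (hM : M ∈ Matrix.specialUnitaryGroup (Fin 2) ℂ) :
    M 1 0 = -star (M 0 1) ∧ M 1 1 = star (M 0 0) ∧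
      M 0 0 * star (M 0 0) + M 0 1 * star (M 0 1) = 1 := by
  rw [Matrix.mem_specialUnitaryGroup_iff, Matrix.mem_unitaryGroup_iff, Matrix.det_fin_two] at hM
  obtain ⟨h1, h2⟩ := hM
  have h00 := congrFun (congrFun h1 0) 0
  have h10 := congrFun (congrFun h1 1) 0
  simp only [Matrix.mul_apply, Fin.sum_univ_two, Matrix.star_apply, Matrix.one_apply_eq,
    Matrix.one_apply_ne (one_ne_zero : (1 : Fin 2) ≠ 0)] at h00 h10
  refine ⟨?_, ?_, h00⟩
  · linear_combination (-M 1 0) * h00 + M 0 0 * h10 - star (M 0 1) * h2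
  · linear_combination (-M 1 1) * h00 + M 0 1 * h10 + star (M 0 0) * h2

/-- Pointwise unitarity on the torus turns into identities between Laurent polynomials. -/
theorem SatisfiesConditions.isQSP {F : MatLaurent} {da db : ℕ} (h : SatisfiesConditions F da db) :
    F = quatMat (F 0 0) (F 0 1) ∧ IsQSP (F 0 0) (F 0 1) da db := by
  have hsu := fun a b => specialUnitaryGroup_relations (h.mem_su a b)
  simp only [matEval, Matrix.map_apply] at hsu
  refine ⟨?_, ?_, fun m hm => ?_, fun m hm => ?_⟩
  · rw [quatMat_eq]
    ext i j : 1
    fin_cases i <;> fin_cases j <;> simp only [Fin.zero_eta, Fin.mk_one, Matrix.cons_val',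
      Matrix.cons_val_zero, Matrix.cons_val_one, Matrix.cons_val_fin_one, Matrix.of_apply]
    · refine ext_of_torus fun a b => ?_
      rw [map_neg, evalAt_dag]
      exact (hsu a b).1
    · refine ext_of_torus fun a b => ?_
      rw [evalAt_dag]
      exact (hsu a b).2.1
  · refine ext_of_torus fun a b => ?_
    rw [map_add, map_mul, map_mul, evalAt_dag, evalAt_dag, map_one]
    exact (hsu a b).2.2
  all_goals
    have h1 := (le_matDegA F _ _ m hm).trans h.degA_le
    have h2 := (le_matDegB F _ _ m hm).trans h.degB_le
    refine ⟨by rw [Int.abs_eq_natAbs]; exact_mod_cast h1,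
      by rw [Int.abs_eq_natAbs]; exact_mod_cast h2,
      parityA_coeff (fun a b => ?_) m hm, parityB_coeff (fun a b => ?_) m hm⟩
    · simpa [matEval] using congrFun (congrFun (h.parityA a b) _) _
    · simpa [matEval] using congrFun (congrFun (h.parityB a b) _) _

theorem SatisfiesConditions.hasProductDecomposition {F : MatLaurent} {da db : ℕ}
    (h : SatisfiesConditions F da db) (hdeg : matDegA F ≤ 1 ∨ matDegB F ≤ 1) :
    HasProductDecomposition F := by
  obtain ⟨hF, hq⟩ := h.isQSP
  rw [hF]
  rcases hdeg with hdeg | hdeg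
  · have hle : ∀ j m, (F 0 j).coeff m ≠ 0 → |m.1| ≤ 1 := fun j m hm => by
      rw [Int.abs_eq_natAbs]; exact_mod_cast (le_matDegA F 0 j m hm).trans hdeg
    refine .of_swap (hq.swap.decomposition_of_degB_le_one ?_ ?_) <;> intro m hm <;>
      rw [coeff_swapVars] at hm <;> exact hle _ _ hm
  · have hle : ∀ j m, (F 0 j).coeff m ≠ 0 → |m.2| ≤ 1 := fun j m hm => by
      rw [Int.abs_eq_natAbs]; exact_mod_cast (le_matDegB F 0 j m hm).trans hdeg
    exact hq.decomposition_of_degB_le_one (hle 0) (hle 1)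

/-! ### The leading coefficient in `b` of a product -/

theorem partB_add (k : ℤ) (p q : BiLaurent) : partB k (p + q) = partB k p + partB k q := by
  ext m
  simp only [AddMonoidAlgebra.coeff_add, Finsupp.add_apply, coeff_partB]
  split_ifs <;> simp

theorem partB_smul (k : ℤ) (c : ℂ) (p : BiLaurent) : partB k (c • p) = c • partB k p := by
  ext m
  simp only [AddMonoidAlgebra.coeff_smul, Finsupp.smul_apply, coeff_partB]
  split_ifs <;> simp

theorem partB_neg (k : ℤ) (p : BiLaurent) : partB k (-p) = -partB k p := by
  simpa using partB_smul k (-1) p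

theorem partB_sub (k : ℤ) (p q : BiLaurent) : partB k (p - q) = partB k p - partB k q := by
  rw [sub_eq_add_neg, partB_add, partB_neg, ← sub_eq_add_neg]

theorem partB_mono (k j l : ℤ) : partB k (mono j l) = if l = k then mono j l else 0 := by
  ext m
  rw [coeff_partB]
  by_cases h : m = (j, l)
  · subst h; split_ifs <;> simp
  · split_ifs <;> simp [coeff_mono, h]

theorem partB_mono_mul (k l : ℤ) (p : BiLaurent) :
    partB k (mono 0 l * p) = mono 0 l * partB (k - l) p := by
  ext m
  rw [coeff_partB, coeff_mono_mul, coeff_mono_mul, coeff_partB]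
  simp [sub_left_inj]

theorem partB_eq_self {k : ℤ} {p : BiLaurent} (hp : IsHomogB k p) : partB k p = p := by
  ext m
  rw [coeff_partB]
  split_ifs with h
  · rfl
  · by_contra h'
    exact h (hp m (Ne.symm h'))

theorem partB_mul {s : BiLaurent} (hs : IsHomogB 0 s) (k : ℤ) (p : BiLaurent) :
    partB k (s * p) = s * partB k p := by
  have h1 : s * p = s * partB k p + s * (p - partB k p) := by ring
  have h2 : IsHomogB k (s * partB k p) := by simpa using hs.mul (isHomogB_partB k p)
  have h3 : partB k (s * (p - partB k p)) = 0 := by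
    ext m
    rw [coeff_partB]
    split_ifs with hm
    · by_contra hne
      obtain ⟨m₁, m₂, h₁, h₂, h⟩ := exists_coeff_of_coeff_mul_ne_zero hne
      have := hs _ h₁
      have hk : m₂.2 = k := by rw [← hm, ← h, Prod.snd_add, this, zero_add]
      simp [coeff_partB, hk] at h₂
    · rfl
  rw [h1, partB_add, h3, partB_eq_self h2, add_zero]

theorem partB_eq_zero {k r : ℤ} {p : BiLaurent} (hp : ∀ m, p.coeff m ≠ 0 → m.2 ≤ r) (h : r < k) :
    partB k p = 0 := by
  ext m
  rw [coeff_partB]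
  split_ifs with hm
  · by_contra hne
    have := hp m hne
    omega
  · rfl

/-- The matrix `quatMat s t` depends on `a` only and has determinant one, so it takes values in
`SU(2)`. No parity is required. -/
structure IsUnitaryA (s t : BiLaurent) : Prop where
  homog_left : IsHomogB 0 s
  homog_right : IsHomogB 0 t
  norm : s * dag s + t * dag t = 1

theorem quatMat_mul (s t s' t' : BiLaurent) :
    quatMat s t * quatMat s' t' = quatMat (s * s' - t * dag t') (s * t' + t * dag s') := by
  simp only [quatMat_eq, Matrix.mul_fin_two, map_add, map_sub, map_mul, dag_dag]
  congr! 2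
  · congr! 1; ring
  · congr! 2
    · ring
    · congr! 1; ring

theorem IsUnitaryA.mul {s t s' t' : BiLaurent} (h : IsUnitaryA s t) (h' : IsUnitaryA s' t') :
    IsUnitaryA (s * s' - t * dag t') (s * t' + t * dag s') where
  homog_left := (h.homog_left.mul h'.homog_left).sub (h.homog_right.mul h'.homog_right.dag)
  homog_right := (h.homog_left.mul h'.homog_right).add (h.homog_right.mul h'.homog_left.dag)
  norm := by
    simp only [map_add, map_sub, map_mul, dag_dag]
    linear_combination (s' * dag s' + t' * dag t') * h.norm + h'.norm

theorem isUnitaryA_one : IsUnitaryA 1 0 :=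
  ⟨isHomogB_one, fun m hm => absurd (by simp) hm, by simp⟩

theorem quatMat_one_zero : quatMat 1 0 = 1 := by
  rw [quatMat_eq, Matrix.one_fin_two]; simp

/-- Alternating products `M₀ signal(b) M₁ signal(b) ⋯ M_r` in which the `M_i` are `SU(2)`-valued
Laurent polynomials in `a` and no cancellation in the degree of `b` occurs: in each step the first
row of the right factor `N` attains the degree `r`. -/
inductive BReduced : ℕ → MatLaurent → Prop
  | base {s t : BiLaurent} (h : IsUnitaryA s t) : BReduced 0 (quatMat s t)
  | step {s t : BiLaurent} (h : IsUnitaryA s t) {r : ℕ} {N : MatLaurent} (hN : BReduced r N)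
      (hne : ∃ j, partB r (N 0 j) ≠ 0) : BReduced (r + 1) (quatMat s t * signal Var.b * N)

theorem quatMat_mul_signal_mul_apply (s t : BiLaurent) (N : MatLaurent) (j : Fin 2) :
    (quatMat s t * signal Var.b * N) 0 j = s * (mono 0 1 * N 0 j) + t * (mono 0 (-1) * N 1 j) ∧
      (quatMat s t * signal Var.b * N) 1 j =
        -dag t * (mono 0 1 * N 0 j) + dag s * (mono 0 (-1) * N 1 j) := by
  constructor <;>
    simp [quatMat_eq, signal, Matrix.mul_apply, Fin.sum_univ_two, Var.toPoly, Var.invPoly,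
      mul_assoc]

theorem coeff_mul_le {s p : BiLaurent} {k l : ℤ} (hs : ∀ m, s.coeff m ≠ 0 → m.2 ≤ k)
    (hp : ∀ m, p.coeff m ≠ 0 → m.2 ≤ l) (m : ℤ × ℤ) (hm : (s * p).coeff m ≠ 0) : m.2 ≤ k + l := by
  obtain ⟨m₁, m₂, h₁, h₂, rfl⟩ := exists_coeff_of_coeff_mul_ne_zero hm
  exact add_le_add (hs _ h₁) (hp _ h₂)

theorem coeff_add_le {p q : BiLaurent} {k : ℤ} (hp : ∀ m, p.coeff m ≠ 0 → m.2 ≤ k)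
    (hq : ∀ m, q.coeff m ≠ 0 → m.2 ≤ k) (m : ℤ × ℤ) (hm : (p + q).coeff m ≠ 0) : m.2 ≤ k := by
  by_cases h : p.coeff m = 0
  · exact hq m (by simpa [h] using hm)
  · exact hp m h

theorem BReduced.le {r : ℕ} {F : MatLaurent} (h : BReduced r F) (i j : Fin 2) (m : ℤ × ℤ)
    (hm : (F i j).coeff m ≠ 0) : m.2 ≤ r := by
  have mono_le : ∀ l : ℤ, ∀ m, (mono 0 l).coeff m ≠ 0 → m.2 ≤ l := by
    intro l m hm
    rw [coeff_mono] at hm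
    by_contra h
    exact hm (if_neg fun h' => h (by rw [h']))
  have homog_le : ∀ s : BiLaurent, IsHomogB 0 s → ∀ m, s.coeff m ≠ 0 → m.2 ≤ 0 :=
    fun s hs m hm => (hs m hm).le
  induction h generalizing i j m with
  | @base s t h =>
    fin_cases i <;> fin_cases j
    · exact homog_le _ h.homog_left m hm
    · exact homog_le _ h.homog_right m hm
    · exact homog_le _ h.homog_right.dag.neg m hm
    · exact homog_le _ h.homog_left.dag m hm
  | @step s t h r N hN hne ih =>
    have key : ∀ u v : BiLaurent, IsHomogB 0 u → IsHomogB 0 v →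
        (u * (mono 0 1 * N 0 j) + v * (mono 0 (-1) * N 1 j)).coeff m ≠ 0 → m.2 ≤ (r + 1 : ℕ) := by
      intro u v hu hv hm
      refine coeff_add_le (fun m hm => ?_) (fun m hm => ?_) m hm
      · have := coeff_mul_le (homog_le u hu) (coeff_mul_le (mono_le 1) (ih 0 j)) m hm
        push_cast; omega
      · have := coeff_mul_le (homog_le v hv) (coeff_mul_le (mono_le (-1)) (ih 1 j)) m hm
        push_cast; omega
    have hF := quatMat_mul_signal_mul_apply s t N j
    fin_cases i
    · exact key _ _ h.homog_left h.homog_right (by rw [← hF.1]; exact hm)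
    · exact key _ _ h.homog_right.dag.neg h.homog_left.dag (by rw [← hF.2]; exact hm)

/-- The leading coefficient in `b` of `M * signal b * N` is the first column of `M` times the
leading coefficient of the first row of `N`. -/
theorem BReduced.partB_step {r : ℕ} {N : MatLaurent} (hN : BReduced r N) {s t : BiLaurent}
    (h : IsUnitaryA s t) (j : Fin 2) :
    partB (r + 1 : ℕ) ((quatMat s t * signal Var.b * N) 0 j) =
        s * (mono 0 1 * partB r (N 0 j)) ∧
      partB (r + 1 : ℕ) ((quatMat s t * signal Var.b * N) 1 j) =
        -dag t * (mono 0 1 * partB r (N 0 j)) := by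
  have hF := quatMat_mul_signal_mul_apply s t N j
  have hz : partB ((r + 1 : ℕ) - -1) (N 1 j) = 0 :=
    partB_eq_zero (hN.le 1 j) (by push_cast; omega)
  have hs : ((r + 1 : ℕ) : ℤ) - 1 = r := by push_cast; ring
  constructor
  · rw [hF.1, partB_add, partB_mul h.homog_left, partB_mul h.homog_right, partB_mono_mul,
      partB_mono_mul, hz, hs]
    simp
  · have ht : IsHomogB 0 (-dag t) := h.homog_right.dag.neg
    have hs' : IsHomogB 0 (dag s) := h.homog_left.dag
    rw [hF.2, partB_add, partB_mul ht, partB_mul hs', partB_mono_mul, partB_mono_mul, hz, hs]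
    simp

theorem BReduced.quatMat_mul {r : ℕ} {F : MatLaurent} (hF : BReduced r F) {s t : BiLaurent}
    (h : IsUnitaryA s t) : BReduced r (quatMat s t * F) := by
  cases hF with
  | base h' => rw [MQSP.quatMat_mul]; exact .base (h.mul h')
  | step h' hN hne =>
    rw [← Matrix.mul_assoc, ← Matrix.mul_assoc, MQSP.quatMat_mul]
    exact .step (h.mul h') hN hne

theorem mono_ne_zero (j k : ℤ) : mono j k ≠ 0 := by
  intro h
  simpa [coeff_mono] using congrArg (fun p : BiLaurent => p.coeff (j, k)) h

/-- If the first row of `F = M * signal b * N` has no leading term, then the diagonal of `M`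
vanishes, so `signal b * M * signal b = M` and the two signals cancel. -/
theorem BReduced.signal_b_mul {r : ℕ} {F : MatLaurent} (hF : BReduced r F) :
    ∃ r', BReduced r' (signal Var.b * F) := by
  by_cases hne : ∃ j, partB r (F 0 j) ≠ 0
  · refine ⟨r + 1, ?_⟩
    simpa [quatMat_one_zero] using BReduced.step isUnitaryA_one hF hne
  push Not at hne
  cases hF with
  | @base s t h =>
    have h0 : s = 0 := by
      rw [← partB_eq_self h.homog_left]; exact hne 0
    have h1 : t = 0 := by
      rw [← partB_eq_self h.homog_right]; exact hne 1
    have := h.norm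
    simp [h0, h1] at this
  | @step s t h r N hN hN' =>
    obtain ⟨j, hj⟩ := hN'
    have h0 := hne j
    rw [(hN.partB_step h j).1] at h0
    have hs : s = 0 := (mul_eq_zero.1 h0).resolve_right (mul_ne_zero (mono_ne_zero 0 1) hj)
    subst hs
    have hm : mono 0 (-1) * mono 0 1 = 1 := by
      rw [mono_mul_mono]; exact mono_zero
    have : signal Var.b * (quatMat 0 t * signal Var.b * N) = quatMat 0 t * N := by
      rw [← Matrix.mul_assoc, ← Matrix.mul_assoc]
      congr 1
      simp only [quatMat_eq, signal, Matrix.mul_fin_two, Var.toPoly, Var.invPoly]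
      congr! 2
      · congr! 1
        · ring
        · congr! 1; linear_combination t * hm
      · congr! 2
        · linear_combination (-dag t) * hm
        · congr! 1; simp
    rw [this]
    exact ⟨r, hN.quatMat_mul h⟩

theorem exists_bReduced {F : MatLaurent} (hF : HasProductDecomposition F) :
    ∃ r, BReduced r F := by
  have hconst : ∀ U : Matrix.specialUnitaryGroup (Fin 2) ℂ, ∃ s t, IsUnitaryA s t ∧
      constMat U.1 = quatMat s t := by
    rintro ⟨M, hM⟩
    rw [Matrix.mem_specialUnitaryGroup_iff] at hM
    obtain ⟨h1, h2, h3⟩ := specialUnitaryGroup_relations (Matrix.mem_specialUnitaryGroup_iff.2 hM)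
    refine ⟨algebraMap ℂ _ (M 0 0), algebraMap ℂ _ (M 0 1),
      ⟨isHomogB_algebraMap _, isHomogB_algebraMap _, ?_⟩, ?_⟩
    · rw [dag_algebraMap, dag_algebraMap, ← map_mul, ← map_mul, ← map_add, h3, map_one]
    · ext i j : 1
      rw [quatMat_eq, dag_algebraMap, dag_algebraMap]
      fin_cases i <;> fin_cases j <;> simp [constMat, h1, h2]
  have hsig : signal Var.a = quatMat (mono 1 0) 0 := by
    simp [signal, quatMat_eq, Var.toPoly, Var.invPoly, dag_mono]
  have hmono : IsUnitaryA (mono 1 0) 0 := by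
    refine ⟨fun m hm => ?_, isUnitaryA_one.homog_right, ?_⟩
    · rw [coeff_mono] at hm
      by_contra h
      exact hm (if_neg fun h' => h (by rw [h']))
    · rw [dag_mono, mono_mul_mono, map_zero, mul_zero, add_zero]
      exact mono_zero
  refine HasProductDecomposition.induction (motive := fun F => ∃ r, BReduced r F) ?_ ?_ hF
  · intro U
    obtain ⟨s, t, h, e⟩ := hconst U
    exact ⟨0, e ▸ .base h⟩
  · rintro U v G ⟨r, hG⟩
    obtain ⟨s, t, h, e⟩ := hconst U
    rw [e, Matrix.mul_assoc]
    cases v with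
    | a =>
      rw [hsig]
      exact ⟨r, (hG.quatMat_mul hmono).quatMat_mul h⟩
    | b =>
      obtain ⟨r', hr'⟩ := hG.signal_b_mul
      exact ⟨r', hr'.quatMat_mul h⟩

/-- The coefficient matrix of the leading power of `b` in a product has all its columns proportional
to one column `(s, -dag t)` that has norm one on the torus. -/
theorem HasProductDecomposition.exists_column {F : MatLaurent} (hF : HasProductDecomposition F)
    {n : ℕ} (hn : n ≠ 0) (hle : ∀ i j m, (F i j).coeff m ≠ 0 → m.2 ≤ n)
    (hne : ∃ i j, partB n (F i j) ≠ 0) :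
    ∃ s t, IsUnitaryA s t ∧ ∀ j, s * partB n (F 1 j) = -dag t * partB n (F 0 j) := by
  have exists_coeff : ∀ (k : ℤ) (p : BiLaurent), partB k p ≠ 0 → ∃ m, p.coeff m ≠ 0 ∧ m.2 = k := by
    intro k p hp
    by_contra! h
    refine hp ?_
    ext m
    rw [coeff_partB]
    split_ifs with hm
    · by_contra h0
      exact h m h0 hm
    · rfl
  obtain ⟨r, hr⟩ := exists_bReduced hF
  have hnr : n ≤ r := by
    obtain ⟨i, j, hij⟩ := hne
    obtain ⟨m, hm, hm'⟩ := exists_coeff _ _ hij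
    have := hr.le i j m hm
    omega
  cases hr with
  | base h => omega
  | @step s t h r N hN hN' =>
    have key := hN.partB_step h
    have hrn : r + 1 ≤ n := by
      obtain ⟨j, hj⟩ := hN'
      have hj' := mul_ne_zero (mono_ne_zero 0 1) hj
      have : ∃ i, partB (r + 1 : ℕ) ((quatMat s t * signal Var.b * N) i j) ≠ 0 := by
        by_contra! h0
        have e0 := h0 0
        have e1 := h0 1
        rw [(key j).1, mul_eq_zero, or_iff_left hj'] at e0
        rw [(key j).2, mul_eq_zero, or_iff_left hj', neg_eq_zero] at e1
        have := h.norm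
        simp [e0, e1] at this
      obtain ⟨i, hi⟩ := this
      obtain ⟨m, hm, hm'⟩ := exists_coeff _ _ hi
      have := hle i j m hm
      omega
    obtain rfl : n = r + 1 := by omega
    refine ⟨s, t, h, fun j => ?_⟩
    rw [(key j).1, (key j).2]
    ring

/-! ### The counterexample of degree two in both variables -/

theorem star_kappa : star kappa = kappa := by
  simp only [kappa, Complex.star_def, Complex.conj_ofReal]

theorem kappa_mul_self : kappa * kappa = 36 / 625 * (37 / 493) := by
  rw [kappa, ← Complex.ofReal_mul]
  have : (6 / 25 * Real.sqrt (37 / 493)) * (6 / 25 * Real.sqrt (37 / 493)) =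
      36 / 625 * (37 / 493) := by
    have := Real.mul_self_sqrt (show (0 : ℝ) ≤ 37 / 493 by norm_num)
    linear_combination 36 / 625 * this
  rw [this]
  push_cast
  ring

theorem kappa_ne_zero : kappa ≠ 0 := by
  intro h
  have := kappa_mul_self
  norm_num [h] at this

theorem coeff_P22_eq_zero {m : ℤ × ℤ}
    (hm : ¬ (|m.1| ≤ 2 ∧ |m.2| ≤ 2 ∧ Even m.1 ∧ Even m.2)) : P22.coeff m = 0 := by
  have h : ∀ j k : ℤ, (|j| ≤ 2 ∧ |k| ≤ 2 ∧ Even j ∧ Even k) → m ≠ (j, k) := by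
    rintro j k h rfl
    exact hm h
  simp [P22, coeff_mono, h 2 2 (by decide), h (-2) (-2) (by decide), h 0 2 (by decide),
    h 0 (-2) (by decide), h (-2) 2 (by decide), h 2 (-2) (by decide), h 2 0 (by decide),
    h (-2) 0 (by decide), h 0 0 (by decide)]

theorem coeff_Q22_eq_zero {m : ℤ × ℤ}
    (hm : ¬ (|m.1| ≤ 2 ∧ |m.2| ≤ 2 ∧ Even m.1 ∧ Even m.2)) : Q22.coeff m = 0 := by
  have h : ∀ j k : ℤ, (|j| ≤ 2 ∧ |k| ≤ 2 ∧ Even j ∧ Even k) → m ≠ (j, k) := by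
    rintro j k h rfl
    exact hm h
  simp [Q22, coeff_mono, h 2 2 (by decide), h (-2) (-2) (by decide), h 0 2 (by decide),
    h 0 (-2) (by decide), h (-2) 2 (by decide), h 2 (-2) (by decide), h 2 0 (by decide),
    h (-2) 0 (by decide)]

theorem coeff_F22 (i j : Fin 2) (m : ℤ × ℤ) (hm : (F22 i j).coeff m ≠ 0) :
    |m.1| ≤ 2 ∧ |m.2| ≤ 2 ∧ Even m.1 ∧ Even m.2 := by
  by_contra h
  have h' : ¬ (|(-m).1| ≤ 2 ∧ |(-m).2| ≤ 2 ∧ Even (-m).1 ∧ Even (-m).2) := by simpa using h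
  rw [F22, quatMat_eq] at hm
  fin_cases i <;> fin_cases j <;>
    simp [coeff_dag, coeff_P22_eq_zero h, coeff_Q22_eq_zero h, coeff_P22_eq_zero h',
      coeff_Q22_eq_zero h'] at hm

theorem coeff_P22_two_two : P22.coeff (2, 2) = kappa := by
  simp [P22, coeff_mono]

theorem natAbs_le_two {n : ℤ} (h : |n| ≤ 2) : n.natAbs ≤ 2 := by
  rw [abs_le] at h
  omega

theorem matDegA_F22 : matDegA F22 = 2 := by
  refine le_antisymm (Finset.sup_le fun ij _ => Finset.sup_le fun m hm => ?_) ?_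
  · exact natAbs_le_two (coeff_F22 _ _ m (Finsupp.mem_support_iff.1 hm)).1
  · refine le_matDegA F22 0 0 (2, 2) ?_
    change P22.coeff (2, 2) ≠ 0
    rw [coeff_P22_two_two]
    exact kappa_ne_zero

theorem matDegB_F22 : matDegB F22 = 2 := by
  refine le_antisymm (Finset.sup_le fun ij _ => Finset.sup_le fun m hm => ?_) ?_
  · exact natAbs_le_two (coeff_F22 _ _ m (Finsupp.mem_support_iff.1 hm)).2.1
  · refine le_matDegB F22 0 0 (2, 2) ?_
    change P22.coeff (2, 2) ≠ 0
    rw [coeff_P22_two_two]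
    exact kappa_ne_zero

theorem evalAt_neg_left {p : BiLaurent} (hp : ∀ m, p.coeff m ≠ 0 → Even m.1) (a b : ℂˣ) :
    evalAt (-a) b p = evalAt a b p := by
  rw [evalAt_eq_sum, evalAt_eq_sum]
  refine Finset.sum_congr rfl fun m hm => ?_
  rw [Units.val_neg, (hp m (Finsupp.mem_support_iff.1 hm)).neg_zpow]

theorem evalAt_neg_right {p : BiLaurent} (hp : ∀ m, p.coeff m ≠ 0 → Even m.2) (a b : ℂˣ) :
    evalAt a (-b) p = evalAt a b p := by
  rw [evalAt_eq_sum, evalAt_eq_sum]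
  refine Finset.sum_congr rfl fun m hm => ?_
  rw [Units.val_neg, (hp m (Finsupp.mem_support_iff.1 hm)).neg_zpow]

/-- The unitarity of the counterexample at `A = a ^ 2` and `B = b ^ 2`, after separating the real
and imaginary parts of the coefficients of its entries. -/
theorem sum_of_squares {K : Type*} [Field K] [CharZero K] {A B : K} (hA : A ≠ 0) (hB : B ≠ 0) :
    (A * B + A⁻¹ * B⁻¹ - 122 / 37 * (B + B⁻¹) + 114 / 37 * (A⁻¹ * B + A * B⁻¹)
        + 362 / 111 * (A + A⁻¹) + 692 / 111) ^ 2
      + (-(8 / 37) * (B + B⁻¹) + 56 / 37 * (A⁻¹ * B + A * B⁻¹) - 248 / 111 * (A + A⁻¹)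
        - 719 / 222) ^ 2
      - (A * B - A⁻¹ * B⁻¹ - 122 / 37 * (B - B⁻¹) + 56 / 37 * (A⁻¹ * B - A * B⁻¹)
        + 362 / 111 * (A - A⁻¹)) ^ 2
      - (-(66 / 37) * (B - B⁻¹) + 114 / 37 * (A⁻¹ * B - A * B⁻¹) - 418 / 111 * (A - A⁻¹)) ^ 2 =
    625 / 36 * (493 / 37) := by
  field_simp
  ring

theorem normSq_P22_add_normSq_Q22 (a b : Circle) :
    evalAt (Circle.toUnits a) (Circle.toUnits b) P22 *
        star (evalAt (Circle.toUnits a) (Circle.toUnits b) P22) +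
      evalAt (Circle.toUnits a) (Circle.toUnits b) Q22 *
        star (evalAt (Circle.toUnits a) (Circle.toUnits b) Q22) = 1 := by
  obtain ⟨A, hA⟩ : ∃ A : ℂ, A = (a : ℂ) ^ 2 := ⟨_, rfl⟩
  obtain ⟨B, hB⟩ : ∃ B : ℂ, B = (b : ℂ) ^ 2 := ⟨_, rfl⟩
  have hA0 : A ≠ 0 := hA ▸ pow_ne_zero 2 a.coe_ne_zero
  have hB0 : B ≠ 0 := hB ▸ pow_ne_zero 2 b.coe_ne_zero
  have sA : (starRingEnd ℂ) A = A⁻¹ := by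
    rw [hA, map_pow, ← Circle.coe_inv_eq_conj, Circle.coe_inv, inv_pow]
  have sB : (starRingEnd ℂ) B = B⁻¹ := by
    rw [hB, map_pow, ← Circle.coe_inv_eq_conj, Circle.coe_inv, inv_pow]
  have sk := star_kappa
  rw [Complex.star_def] at sk
  have zA : (a : ℂ) ^ (2 : ℤ) = A := by rw [hA]; norm_cast
  have zB : (b : ℂ) ^ (2 : ℤ) = B := by rw [hB]; norm_cast
  have zA' : (a : ℂ) ^ (-2 : ℤ) = A⁻¹ := by rw [zpow_neg, zA]
  have zB' : (b : ℂ) ^ (-2 : ℤ) = B⁻¹ := by rw [zpow_neg, zB]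
  simp only [P22, Q22, map_smul, map_add, map_sub, evalAt_mono, Circle.toUnits_apply,
    Units.val_mk0, zA, zB, zA', zB', zpow_zero, smul_eq_mul, Complex.star_def, map_mul, map_div₀,
    map_inv₀, sA, sB, sk, Complex.conj_I, map_ofNat, map_one, inv_inv]
  obtain ⟨A', hA'⟩ : ∃ A', A' = A⁻¹ := ⟨_, rfl⟩
  obtain ⟨B', hB'⟩ : ∃ B', B' = B⁻¹ := ⟨_, rfl⟩
  have key := sum_of_squares hA0 hB0
  rw [← hA', ← hB'] at key ⊢
  linear_combination kappa * kappa * key + 625 / 36 * (493 / 37) * kappa_mul_self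
    - kappa * kappa * ((-(8 / 37) * (B + B') + 56 / 37 * (A' * B + A * B') - 248 / 111 * (A + A')
        - 719 / 222) ^ 2 - (-(66 / 37) * (B - B') + 114 / 37 * (A' * B - A * B')
        - 418 / 111 * (A - A')) ^ 2) * Complex.I_mul_I

theorem satisfiesConditions_F22 : SatisfiesConditions F22 2 2 where
  degA_le := matDegA_F22.le
  degB_le := matDegB_F22.le
  mem_su a b := by
    have h := normSq_P22_add_normSq_Q22 a b
    have hF : matEval F22 (Circle.toUnits a) (Circle.toUnits b) =
        (suMatrix (star (evalAt (Circle.toUnits a) (Circle.toUnits b) P22))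
          (-evalAt (Circle.toUnits a) (Circle.toUnits b) Q22)
          (by rw [star_star, star_neg]; linear_combination h)).1 := by
      ext i j
      rw [matEval, F22, quatMat_eq]
      fin_cases i <;> fin_cases j <;> simp [suMatrix, evalAt_dag, -Circle.toUnits_apply]
    rw [hF]
    exact Subtype.property _
  parityA a b := by
    ext i j
    simpa [matEval] using evalAt_neg_left (fun m hm => (coeff_F22 i j m hm).2.2.1) a b
  parityB a b := by
    ext i j
    simpa [matEval] using evalAt_neg_right (fun m hm => (coeff_F22 i j m hm).2.2.2) a b

/-- A point `u` with `u ^ 2 + u ^ (-2) = 3`. Here the two products `P₂ dag P₂` and `Q₂ dag Q₂`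
formed from the leading coefficients in `b` of the counterexample are opposite to each other. -/
theorem exists_golden_unit : ∃ (u : ℂˣ) (g : ℝ), g ^ 2 = g + 1 ∧
    (u : ℂ) ^ (2 : ℤ) = (g : ℂ) + 1 ∧ (u : ℂ) ^ (-2 : ℤ) = 2 - (g : ℂ) := by
  obtain ⟨g, hg⟩ : ∃ g : ℝ, g ^ 2 = g + 1 := ⟨_, Real.goldenRatio_sq⟩
  have hg' : (g : ℂ) ^ 2 = g + 1 := by exact_mod_cast congrArg ((↑) : ℝ → ℂ) hg
  have h0 : (g : ℂ) ≠ 0 := by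
    intro h
    simp [h] at hg'
  have h2 : ((Units.mk0 (g : ℂ) h0 : ℂˣ) : ℂ) ^ (2 : ℤ) = (g : ℂ) + 1 := by
    rw [Units.val_mk0, ← hg']; norm_cast
  refine ⟨Units.mk0 g h0, g, hg, h2, ?_⟩
  rw [zpow_neg, h2]
  exact inv_eq_of_mul_eq_one_right (by linear_combination -hg')

/-- Its coefficient of `b ^ 2` has the first column `(P₂, Q₂')`. If that is proportional to a
column `(s, -dag t)` of norm one, then `s dag s * Q₂' dag Q₂' = t dag t * P₂ dag P₂`. At the
golden unit the two products are nonzero and differ by the sign only, so `s dag s + t dag t = 1`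
is impossible. -/
theorem not_hasProductDecomposition_F22 : ¬ HasProductDecomposition F22 := by
  intro hF
  have hP : partB 2 P22 = kappa • (mono 2 2 - (122 / 37 + 8 * Complex.I / 37 : ℂ) • mono 0 2 +
      (114 / 37 + 56 * Complex.I / 37 : ℂ) • mono (-2) 2) := by
    simp [P22, partB_add, partB_sub, partB_smul, partB_mono]
  have hQ : partB (-2) Q22 = kappa • (-mono (-2) (-2) +
      (122 / 37 + 66 * Complex.I / 37 : ℂ) • mono 0 (-2) -
      (56 / 37 + 114 * Complex.I / 37 : ℂ) • mono 2 (-2)) := by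
    simp [Q22, partB_add, partB_sub, partB_smul, partB_mono]
    module
  have hQd : partB 2 (dag Q22) = dag (partB (-2) Q22) := by
    ext m
    simp only [coeff_partB, coeff_dag, Prod.snd_neg, neg_inj]
    split_ifs <;> simp
  obtain ⟨s, t, hst, h⟩ := hF.exists_column (n := 2) two_ne_zero
    (fun i j m hm => (abs_le.1 (coeff_F22 i j m hm).2.1).2) ⟨0, 0, fun h0 => by
      have := congrArg (fun p : BiLaurent => p.coeff (2, 2)) h0
      simp only [coeff_partB] at this
      exact kappa_ne_zero (coeff_P22_two_two.symm.trans (by simpa [F22, quatMat_eq] using this))⟩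
  have h1 : s * dag (partB (-2) Q22) = dag t * partB 2 P22 := by
    have := h 0
    simp only [Nat.cast_ofNat, F22, quatMat_eq, Matrix.of_apply, Matrix.cons_val',
      Matrix.cons_val_zero, Matrix.cons_val_one, Matrix.cons_val_fin_one, partB_neg, hQd] at this
    linear_combination -this
  have h2 : dag s * partB (-2) Q22 = t * dag (partB 2 P22) := by
    simpa using congrArg dag h1
  obtain ⟨u, g, hg, z1, z2⟩ := exists_golden_unit
  have hg' : (g : ℂ) ^ 2 = g + 1 := by exact_mod_cast congrArg ((↑) : ℝ → ℂ) hg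
  have e0 := congrArg (evalAt u 1) hst.norm
  have e1 := congrArg (evalAt u 1) h1
  have e2 := congrArg (evalAt u 1) h2
  have sk := star_kappa
  rw [Complex.star_def] at sk
  simp only [map_mul, map_add, map_one] at e0 e1 e2
  have vP : evalAt u 1 (partB 2 P22) = kappa * (g + 1 - (122 / 37 + 8 * Complex.I / 37) +
      (114 / 37 + 56 * Complex.I / 37) * (2 - g)) := by
    simp only [hP, evalAt_mono, z1, z2, map_smul, map_sub, map_add, smul_eq_mul, Units.val_one,
      one_zpow, zpow_zero, mul_one]
  have vP' : evalAt u 1 (dag (partB 2 P22)) =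
      kappa * (2 - g - (122 / 37 - 8 * Complex.I / 37) +
      (114 / 37 - 56 * Complex.I / 37) * (g + 1)) := by
    simp only [hP, dag_smul, dag_mono, map_smul, map_sub, map_add, smul_eq_mul, evalAt_mono, z1,
      z2, sk, neg_neg, neg_zero, Units.val_one, one_zpow, zpow_zero, mul_one, Complex.star_def,
      map_mul, map_div₀, Complex.conj_I, map_ofNat]
    ring
  have vQ : evalAt u 1 (partB (-2) Q22) =
      kappa * (-(2 - g) + (122 / 37 + 66 * Complex.I / 37) -
      (56 / 37 + 114 * Complex.I / 37) * (g + 1)) := by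
    simp only [hQ, evalAt_mono, z1, z2, map_smul, map_sub, map_add, map_neg, smul_eq_mul,
      Units.val_one, one_zpow, zpow_zero, mul_one]
  have vQ' : evalAt u 1 (dag (partB (-2) Q22)) =
      kappa * (-(g + 1) + (122 / 37 - 66 * Complex.I / 37) -
      (56 / 37 - 114 * Complex.I / 37) * (2 - g)) := by
    simp only [hQ, dag_smul, dag_mono, map_smul, map_sub, map_add, map_neg, smul_eq_mul,
      evalAt_mono, z1, z2, sk, neg_neg, neg_zero, Units.val_one, one_zpow, zpow_zero, mul_one,
      Complex.star_def, map_mul, map_div₀, Complex.conj_I, map_ofNat]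
    ring
  -- modulo `g ^ 2 = g + 1` and `I ^ 2 = -1`
  have hanti : evalAt u 1 (partB (-2) Q22) * evalAt u 1 (dag (partB (-2) Q22)) =
      -(evalAt u 1 (partB 2 P22) * evalAt u 1 (dag (partB 2 P22))) := by
    rw [vP, vP', vQ, vQ']
    linear_combination kappa * kappa / 1369 *
      ((-12768 - 16132 * (g : ℂ) + 16132 * (g : ℂ) ^ 2) * Complex.I_mul_I - 22422 * hg')
  have hzero : evalAt u 1 (partB 2 P22) * evalAt u 1 (dag (partB 2 P22)) = 0 := by
    linear_combination (-(evalAt u 1 (partB 2 P22) * evalAt u 1 (dag (partB 2 P22)))) * e0 +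
      evalAt u 1 s * evalAt u 1 (dag s) * hanti
      - evalAt u 1 (dag s) * evalAt u 1 (partB (-2) Q22) * e1
      - evalAt u 1 (dag t) * evalAt u 1 (partB 2 P22) * e2
  rw [vP, vP', mul_eq_zero, mul_eq_zero, mul_eq_zero, or_iff_right kappa_ne_zero,
    or_iff_right kappa_ne_zero] at hzero
  rcases hzero with h0 | h0
  · have him := congrArg Complex.im h0
    simp at him
    have : g = 13 / 7 := by linarith
    norm_num [this] at hg
  · have him := congrArg Complex.im h0
    simp at him
    have : g = -6 / 7 := by linarith
    norm_num [this] at hg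

/-! ### Inversion symmetries and the restricted products -/

theorem invVars_smul (c : ℂ) (p : BiLaurent) : invVars (c • p) = c • invVars p := by
  ext m; simp [coeff_invVars]

theorem invVars_mono (j k : ℤ) : invVars (mono j k) = mono (-j) (-k) := by
  simp [invVars, mono]

theorem invVars_P22 : invVars P22 = P22 := by
  simp only [P22, invVars_smul, map_add, map_sub, invVars_mono, neg_neg, neg_zero]
  module

theorem invVars_Q22 : invVars Q22 = -Q22 := by
  simp only [Q22, invVars_smul, map_add, map_sub, invVars_mono, neg_neg, neg_zero]
  module

/-- The signal `signalX v` is conjugate to `signal v` by a constant rotation of angle `π / 4`. -/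
theorem HasRestrictedDecomposition.hasProductDecomposition {F : MatLaurent}
    (hF : HasRestrictedDecomposition F) : HasProductDecomposition F := by
  obtain ⟨d, φ, c, rfl⟩ := hF
  have hrot : ∀ φ : ℝ, ∃ U : Matrix.specialUnitaryGroup (Fin 2) ℂ, U.1 = rotZ φ := by
    intro φ
    refine ⟨suMatrix (Complex.exp (-(φ * Complex.I))) 0 ?_, ?_⟩
    · rw [Complex.star_def, ← Complex.exp_conj]
      simp [← Complex.exp_add]
    · simp only [suMatrix, rotZ, Complex.star_def, ← Complex.exp_conj]
      simp
  -- the entry `1 / √2` of that rotation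
  obtain ⟨r, hr⟩ : ∃ r : ℂ, r = ((Real.sqrt 2)⁻¹ : ℝ) := ⟨_, rfl⟩
  have hrr : r * r = 1 / 2 := by
    rw [hr, ← Complex.ofReal_mul, ← mul_inv, Real.mul_self_sqrt zero_le_two]
    norm_num
  have hstar : star r = r := by rw [hr, Complex.star_def, Complex.conj_ofReal]
  have hX : ∃ V W : Matrix.specialUnitaryGroup (Fin 2) ℂ, ∀ v,
      signalX v = constMat V.1 * signal v * constMat W.1 := by
    refine ⟨suMatrix r r (by rw [hstar]; linear_combination 2 * hrr),
      suMatrix r (-r) (by rw [star_neg, hstar]; linear_combination 2 * hrr), fun v => ?_⟩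
    have hR : algebraMap ℂ BiLaurent r * algebraMap ℂ BiLaurent r =
        algebraMap ℂ BiLaurent (1 / 2) := by rw [← map_mul, hrr]
    have hV : constMat (suMatrix r r (by rw [hstar]; linear_combination 2 * hrr)).1 =
        !![algebraMap ℂ BiLaurent r, -algebraMap ℂ BiLaurent r;
          algebraMap ℂ BiLaurent r, algebraMap ℂ BiLaurent r] := by
      ext i j : 1
      fin_cases i <;> fin_cases j <;> simp [constMat, suMatrix, hstar, -RCLike.star_def]
    have hW : constMat (suMatrix r (-r) (by rw [star_neg, hstar]; linear_combination 2 * hrr)).1 =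
        !![algebraMap ℂ BiLaurent r, algebraMap ℂ BiLaurent r;
          -algebraMap ℂ BiLaurent r, algebraMap ℂ BiLaurent r] := by
      ext i j : 1
      fin_cases i <;> fin_cases j <;> simp [constMat, suMatrix, hstar, -RCLike.star_def]
    rw [hV, hW, signalX, signal, Matrix.mul_fin_two, Matrix.mul_fin_two]
    simp only [Algebra.smul_def, ← hR]
    congr! 2
    · congr! 1
      · ring
      · congr! 1; ring
    · congr! 2
      · ring
      · congr! 1; ring
  obtain ⟨V, W, hVW⟩ := hX
  induction d with
  | zero =>
    obtain ⟨U, hU⟩ := hrot (φ 0)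
    simpa [hU] using hasProductDecomposition_constMat U
  | succ d ih =>
    obtain ⟨U, hU⟩ := hrot (φ 0)
    have := ((ih (fun i => φ i.succ) fun i => c i.succ).constMat_mul W).cons (U * V) (c 0)
    simpa [List.ofFn_succ, Matrix.mul_assoc, hVW, hU, constMat_mul] using this

theorem coeff_P22_not_proportional_A : ¬ ∃ z : Circle, ∀ k : ℤ,
    P22.coeff (2, k) = (z : ℂ) * Q22.coeff (2, k) := by
  rintro ⟨z, h⟩
  have h2 := h 2
  have h0 := h 0
  simp [P22, Q22, coeff_mono, kappa_ne_zero] at h2 h0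
  rw [h2, one_mul] at h0
  have := congrArg Complex.im (mul_left_cancel₀ kappa_ne_zero h0)
  norm_num at this

theorem coeff_P22_not_proportional_B : ¬ ∃ z : Circle, ∀ j : ℤ,
    P22.coeff (j, 2) = (z : ℂ) * Q22.coeff (j, 2) := by
  rintro ⟨z, h⟩
  have h2 := h 2
  have h0 := h 0
  simp [P22, Q22, coeff_mono, kappa_ne_zero] at h2 h0
  rw [h2, one_mul] at h0
  have := congrArg Complex.im (mul_left_cancel₀ kappa_ne_zero h0)
  norm_num at this

end

end MQSP

theorem theorem4 :
    -- sufficiency when one of the degrees is at most one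
    (∀ (F : MQSP.MatLaurent) (da db : ℕ), MQSP.SatisfiesConditions F da db →
      (MQSP.matDegA F ≤ 1 ∨ MQSP.matDegB F ≤ 1) → MQSP.HasProductDecomposition F) ∧
    -- the counterexample with both degrees equal to two
    (MQSP.SatisfiesConditions MQSP.F22 2 2 ∧
      MQSP.matDegA MQSP.F22 = 2 ∧ MQSP.matDegB MQSP.F22 = 2 ∧
      ¬ MQSP.HasProductDecomposition MQSP.F22) ∧
    -- its inversion symmetries, and the failure of the conjectured restricted characterization
    (MQSP.invVars MQSP.P22 = MQSP.P22 ∧ MQSP.invVars MQSP.Q22 = -MQSP.Q22 ∧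
      ¬ MQSP.HasRestrictedDecomposition MQSP.F22 ∧
      (¬ ∃ z : Circle, ∀ k : ℤ,
        MQSP.P22.coeff (2, k) = (z : ℂ) * MQSP.Q22.coeff (2, k)) ∧
      (¬ ∃ z : Circle, ∀ j : ℤ,
        MQSP.P22.coeff (j, 2) = (z : ℂ) * MQSP.Q22.coeff (j, 2))) := by
  exact ⟨fun F da db h hdeg => h.hasProductDecomposition hdeg,
    ⟨MQSP.satisfiesConditions_F22, MQSP.matDegA_F22, MQSP.matDegB_F22,
      MQSP.not_hasProductDecomposition_F22⟩,
    MQSP.invVars_P22, MQSP.invVars_Q22,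
    fun h => MQSP.not_hasProductDecomposition_F22 h.hasProductDecomposition,
    MQSP.coeff_P22_not_proportional_A, MQSP.coeff_P22_not_proportional_B⟩
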